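/- Setting. Let $M$ be a smooth four-dimensional manifold with a smooth metric $\mathbf g$ of signature $(1,3)$, let $\nabla$ be a smooth connection on $TM$ with $\nabla\mathbf g=0$ and torsion $\tau(u,v)=\nabla_uv-\nabla_vu-[u,v]$, and let $P\to M$ be a spin structure: a principal $\mathrm{Spin}^e_{1,3}$-bundle with an equivariant map onto the positively oriented and time-oriented orthonormal coframes. Let $\mathcal C\ell(M,\mathtt g)$ be the bundle of Clifford algebras of the cotangent spaces (its sections are the Clifford fields) and let $\mathcal C\ell^{\ell}=P\times_\ell\mathbb R_{1,3}$, $\ell(s)a=sa$, be the left spin-Clifford bundle (its sections are the left spin-Clifford fields), a bundle of left modules over $\mathcal C\ell(M,\mathtt g)$. Fix a smooth global section $\Xi$ of $P$ (a spin coframe). Let $\{\theta^a\}$ be its orthonormal coframe, $\{e_a\}$ the dual frame, $\eta=\mathrm{diag}(1,-1,-1,-1)$, $\theta_a=\eta_{ab}\theta^b$, and let $1^\ell_\Xi=[(\Xi,1)]$. Repeated indices are summed from $0$ to $3$. Put $\omega_{ab}^c=\theta^c(\nabla_{e_a}e_b)$ and $\omega_X=\tfrac12\,\eta^{bc}\,\theta^a(\nabla_Xe_c)\,\theta_a\wedge\theta_b$,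 and write $\omega_{a}=\omega_{e_a}$. On Clifford fields let $\nabla$ be the induced covariant derivative (the derivation with $\nabla_{e_a}f=e_a(f)$ on functions and $\nabla_{e_a}\theta^b=-\omega_{ac}^b\theta^c$), and on left spin-Clifford fields let $\nabla^s_X[(\Xi,f)]=[(\Xi,X(f))]+\tfrac12\omega_X[(\Xi,f)]$. Let $\boldsymbol\partial=\theta^a\nabla_{e_a}$ and $\boldsymbol\partial^s=\theta^a\nabla^s_{e_a}$ be the Dirac and spin-Dirac operators. For a Clifford field $A$ put $$(S_2)_{ab}A=\tfrac12(\nabla_{e_b}A)\omega_a+\tfrac12(\nabla_{e_a}A)\omega_b+\tfrac12A(\nabla_{e_a}\omega_b)+\tfrac14A\omega_b\omega_a-\tfrac12\omega_{ab}^cA\omega_c .$$ Every smooth left spin-Clifford field $\psi$ is $\psi=A\,1^\ell_\Xi$ for exactly one smooth Clifford field $A$, and: (1) For every smooth Clifford field $A$ and $\psi=A\,1^\ell_\Xi$, $$(\boldsymbol\partial^s)^2\psi=\big[\boldsymbol\partial^2A+\eta^{ab}(S_2)_{ab}A+(\theta^a\wedge\theta^b)(S_2)_{ab}A\big]1^\ell_\Xi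 .$$ (2) Let $D$ be the Levi-Civita connection of $\mathbf g$, let $\mathring\Gamma_{ab}^c=\theta^c(D_{e_a}e_b)$ and $T_{ab}^c=\theta^c(\tau(e_a,e_b))$, and let $\partial\!\!\!|=\theta^aD_{e_a}$ be the standard Dirac operator on Clifford fields. Assume that the strain tensor of $\nabla$ vanishes, i.e. $\omega_{ab}^c=\mathring\Gamma_{ab}^c+\tfrac12T_{ab}^c$. Then $\tau(X,\cdot)$, carried over to $1$-forms by the metric, is skew-adjoint for every $X$; let $A\mapsto\tau(X,A)$ be its extension to a derivation of the Clifford algebra, and put $$(S_1)_{ab}A=\tfrac12\tau(e_a,D_{e_b}A)+\tfrac12D_{e_a}(\tau(e_b,A))-\tfrac12T_{ab}^cD_{e_c}A-\tfrac12\mathring\Gamma_{ab}^c\tau(e_c,A)+\tfrac14\tau(e_a,\tau(e_b,A))-\tfrac14T_{ab}^c\tau(e_c,A).$$ Then for every smooth Clifford field $A$ and $\psi=A\,1^\ell_\Xi$, $$(\boldsymbol\partial^s)^2\psi=\big[(\partial\!\!\!|)^2A+\eta^{ab}\big((S_1)_{ab}+(S_2)_{ab}\big)A+(\theta^a\wedge\theta^b)\big((S_1)_{ab}+(S_2)_{ab}\big)A\big]1^\ell_\Xi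 .$$ -/

import Mathlib

open scoped Manifold ContDiff

universe u v w

noncomputable section

namespace RiemannCartan

/-! ### The Minkowski space `ℝ^{1,3}`, the spacetime algebra `ℝ_{1,3}`, and `Spin^e_{1,3}` -/

/-- The model space of a four-dimensional manifold. -/
abbrev E4 : Type := EuclideanSpace ℝ (Fin 4)

/-- The model with corners of a four-dimensional manifold without boundary. -/
abbrev I4 : ModelWithCorners ℝ E4 E4 := 𝓘(ℝ, E4)

/-- `η = diag(1, -1, -1, -1)`; numerically `η_{ab} = η^{ab}`. -/
def eta (a b : Fin 4) : ℝ := if a = b then (if a = 0 then 1 else -1) else 0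

/-- The quadratic form of Minkowski space, `v ↦ ∑ η_{aa} v_a²`. -/
def minkowskiForm : QuadraticForm ℝ (Fin 4 → ℝ) :=
  QuadraticMap.weightedSumSquares ℝ (fun a : Fin 4 => eta a a)

/-- The spacetime algebra `ℝ_{1,3}`. -/
abbrev Cl13 : Type := CliffordAlgebra minkowskiForm

/-- The group `Spin^e_{1,3}`: the products `u` of an even number of vectors with `u ũ = 1`. -/
abbrev Spin13 : Type := spinGroup minkowskiForm

/-- The multiform basis `E^{i₁} ∧ ⋯ ∧ E^{i_r}` (`i₁ < ⋯ < i_r`) of `ℝ_{1,3}`. -/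
def clBasis : Module.Basis (Finset (Fin 4)) ℝ Cl13 :=
  (Pi.basisFun ℝ (Fin 4)).ExteriorAlgebra.map (CliffordAlgebra.equivExterior minkowskiForm).symm

/-! ### Operations on Clifford algebras -/

section Clifford

variable {V : Type*} [AddCommGroup V] [Module ℝ V]

/-- The exterior product, transported to a Clifford algebra by the canonical linear isomorphism
with the exterior algebra. -/
def wedge {Q : QuadraticForm ℝ V} (A B : CliffordAlgebra Q) : CliffordAlgebra Q :=
  (CliffordAlgebra.equivExterior Q).symm
    (CliffordAlgebra.equivExterior Q A * CliffordAlgebra.equivExterior Q B)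

/-- `T` is skew-adjoint for the polar form of `Q`. -/
def IsSkew (Q : QuadraticForm ℝ V) (T : V →ₗ[ℝ] V) : Prop :=
  ∀ v, QuadraticMap.polar Q v (T v) = 0

/-- `v ↦ v + ε T v`, with values in the dual numbers over the Clifford algebra. -/
def dualLift (Q : QuadraticForm ℝ V) (T : V →ₗ[ℝ] V) :
    V →ₗ[ℝ] TrivSqZeroExt (CliffordAlgebra Q) (CliffordAlgebra Q) where
  toFun v := TrivSqZeroExt.inl (CliffordAlgebra.ι Q v) +
    TrivSqZeroExt.inr (CliffordAlgebra.ι Q (T v))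
  map_add' x y := by ext <;> simp
  map_smul' c x := by ext <;> simp

lemma dualLift_sq {Q : QuadraticForm ℝ V} {T : V →ₗ[ℝ] V} (h : IsSkew Q T) (v : V) :
    dualLift Q T v * dualLift Q T v = algebraMap ℝ _ (Q v) := by
  have key := CliffordAlgebra.ι_mul_ι_add_swap (Q := Q) v (T v)
  rw [h v, map_zero] at key
  rw [TrivSqZeroExt.algebraMap_eq_inl']
  ext
  · simp [dualLift]
  · simpa [dualLift] using key

open Classical in
/-- The derivation of the Clifford algebra `Cℓ(V, Q)` that extends a skew-adjoint endomorphism `T`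
of `V`: it sends `v₁ v₂ ⋯ v_r` to `∑ k, v₁ ⋯ (T v_k) ⋯ v_r`. It exists only for skew-adjoint `T`;
for any other `T` the value is `0`. -/
def extDer (Q : QuadraticForm ℝ V) (T : V →ₗ[ℝ] V) (A : CliffordAlgebra Q) : CliffordAlgebra Q :=
  if h : IsSkew Q T then
    (CliffordAlgebra.lift Q ⟨dualLift Q T, dualLift_sq h⟩ A).snd
  else 0

lemma extDer_ι {Q : QuadraticForm ℝ V} {T : V →ₗ[ℝ] V} (h : IsSkew Q T) (v : V) :
    extDer Q T (CliffordAlgebra.ι Q v) = CliffordAlgebra.ι Q (T v) := by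
  simp [extDer, h, dualLift]

lemma fst_lift_dualLift {Q : QuadraticForm ℝ V} {T : V →ₗ[ℝ] V} (h : IsSkew Q T)
    (A : CliffordAlgebra Q) :
    (CliffordAlgebra.lift Q ⟨dualLift Q T, dualLift_sq h⟩ A).fst = A := by
  have : (TrivSqZeroExt.fstHom ℝ (CliffordAlgebra Q) (CliffordAlgebra Q)).comp
      (CliffordAlgebra.lift Q ⟨dualLift Q T, dualLift_sq h⟩) = AlgHom.id ℝ _ := by
    ext v
    simp [dualLift]
  exact DFunLike.congr_fun this A

lemma extDer_mul {Q : QuadraticForm ℝ V} {T : V →ₗ[ℝ] V} (h : IsSkew Q T)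
    (A B : CliffordAlgebra Q) :
    extDer Q T (A * B) = extDer Q T A * B + A * extDer Q T B := by
  simp [extDer, h, fst_lift_dualLift, add_comm]

end Clifford

/-! ### Lorentz metrics, the Clifford bundle, orthonormal coframes -/

variable {M : Type u} [TopologicalSpace M] [ChartedSpace E4 M] [IsManifold I4 ∞ M]

/-- The cotangent space `T*_x M`. -/
abbrev Cotangent (x : M) : Type := Module.Dual ℝ (TangentSpace I4 x)

instance (x : M) : FiniteDimensional ℝ (TangentSpace I4 x) :=
  inferInstanceAs (FiniteDimensional ℝ E4)

variable (M) in
/-- A smooth metric of signature `(1, 3)` on a four-dimensional manifold. -/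
structure LorentzMetric where
  val (x : M) : TangentSpace I4 x →L[ℝ] TangentSpace I4 x →L[ℝ] ℝ
  symm (x : M) (v w : TangentSpace I4 x) : val x v w = val x w v
  signature (x : M) : ∃ b : Module.Basis (Fin 4) ℝ (TangentSpace I4 x),
    ∀ a c, val x (b a) (b c) = eta a c
  contMDiff : ContMDiff I4 (I4.prod 𝓘(ℝ, E4 →L[ℝ] E4 →L[ℝ] ℝ)) ∞
    (fun x ↦ Bundle.TotalSpace.mk' (E4 →L[ℝ] E4 →L[ℝ] ℝ) x (val x))

namespace LorentzMetric

variable (g : LorentzMetric M)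

/-- The metric at `x` as a bilinear form. -/
def bilin (x : M) : LinearMap.BilinForm ℝ (TangentSpace I4 x) :=
  LinearMap.mk₂ ℝ (fun v w => g.val x v w) (by simp) (by simp) (by simp) (by simp)

lemma bilin_nondegenerate (x : M) : (g.bilin x).Nondegenerate := by
  obtain ⟨b, hb⟩ := g.signature x
  have key : ∀ v, (∀ w, g.val x v w = 0) → v = 0 := by
    intro v hv
    rw [← b.sum_repr v]
    refine Finset.sum_eq_zero fun a _ => ?_
    have h1 := hv (b a)
    rw [← b.sum_repr v] at h1
    simp only [map_sum, map_smul, sum_apply, smul_apply, hb, smul_eq_mul] at h1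
    have h2 : b.repr v a = 0 := by
      rw [Finset.sum_eq_single a] at h1
      · rcases mul_eq_zero.1 h1 with h | h
        · exact h
        · exfalso
          simp only [eta] at h
          split_ifs at h <;> simp_all
      · intro c _ hc
        simp [eta, hc]
      · simp
    rw [h2, zero_smul]
  refine ⟨fun v hv => key v hv, fun v hv => key v fun w => ?_⟩
  rw [g.symm]
  exact hv w

/-- The musical isomorphism `v ↦ g(v, ·)` from `T_x M` to `T*_x M`. -/
def flat (x : M) : TangentSpace I4 x ≃ₗ[ℝ] Cotangent x :=
  (g.bilin x).toDual (g.bilin_nondegenerate x)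

/-- The musical isomorphism from `T*_x M` to `T_x M`. -/
def sharp (x : M) : Cotangent x ≃ₗ[ℝ] TangentSpace I4 x := (g.flat x).symm

/-- The quadratic form of the metric of the cotangent space, `α ↦ g(♯α, ♯α)`. -/
def coform (x : M) : QuadraticForm ℝ (Cotangent x) :=
  (g.bilin x).toQuadraticMap.comp (g.sharp x).toLinearMap

/-- The fibre at `x` of the Clifford bundle `Cℓ(M, g)` of differential forms. -/
abbrev Cl (x : M) : Type := CliffordAlgebra (g.coform x)

/-- Clifford fields: sections of the Clifford bundle (smoothness is imposed separately). -/
abbrev ClField : Type u := (x : M) → g.Cl x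

/-- An orthonormal coframe at `x`, as the isometry `ℝ^{1,3} → T*_x M` that sends the standard
basis `E^a` to the covectors `θ^a` of the coframe. -/
abbrev Coframe (x : M) : Type := QuadraticMap.IsometryEquiv minkowskiForm (g.coform x)

end LorentzMetric

variable {g : LorentzMetric M}

/-- The covectors `θ^a` of an orthonormal coframe. -/
def covec {x : M} (F : g.Coframe x) (a : Fin 4) : Cotangent x := F (Pi.single a 1)

/-- The covector `θ^a` as an element of the Clifford algebra. -/
def th {x : M} (F : g.Coframe x) (a : Fin 4) : g.Cl x := CliffordAlgebra.ι (g.coform x) (covec F a)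

/-- The reciprocal covector `θ_a = η_{ab} θ^b` as an element of the Clifford algebra. -/
def thLow {x : M} (F : g.Coframe x) (a : Fin 4) : g.Cl x := ∑ b, eta a b • th F b

/-- The tangent frame dual to an orthonormal coframe, `e_a = η_{ab} ♯θ^b`. -/
def vec {x : M} (F : g.Coframe x) (a : Fin 4) : TangentSpace I4 x :=
  ∑ b, eta a b • g.sharp x (covec F b)

/-- The algebra isomorphism `ℝ_{1,3} → Cℓ(T*_x M)` with `E^a ↦ θ^a`, determined by a coframe. -/
def gauge {x : M} (F : g.Coframe x) : Cl13 ≃ₐ[ℝ] g.Cl x := CliffordAlgebra.equivOfIsometry F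

/-- A function with values in `ℝ_{1,3}` is smooth on `U` if its components are. -/
def SmoothOnCl (f : M → Cl13) (U : Set M) : Prop :=
  ∀ J, ContMDiffOn I4 𝓘(ℝ, ℝ) ∞ (fun x => clBasis.repr (f x) J) U

/-- The componentwise derivative of a function with values in `ℝ_{1,3}`, along `X ∈ T_x M`. -/
def clDeriv (f : M → Cl13) (x : M) (X : TangentSpace I4 x) : Cl13 :=
  ∑ J, mvfderiv I4 (fun y => clBasis.repr (f y) J) x X • clBasis J

/-! ### Spin structures and the left spin-Clifford bundle -/

/-- A spin structure on `(M, g)`: a principal `Spin^e_{1,3}`-bundle `P` together with a map to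
the orthonormal coframes that is equivariant over the double covering
`u ↦ (E ↦ u E u⁻¹)` of `SO^e_{1,3}`. The bundle is given by its fibres `P x`, which are right
torsors, and by an atlas of local sections with smooth transition functions. The image of `P x` is
one orbit of `SO^e_{1,3}`; it consists of the coframes which are positive for the orientation and
the time orientation of the spacetime. -/
structure SpinStructure (g : LorentzMetric M) where
  P : M → Type v
  rmul {x : M} : P x → Spin13 → P x
  rmul_one {x : M} (p : P x) : rmul p 1 = p
  rmul_mul {x : M} (p : P x) (s t : Spin13) : rmul p (s * t) = rmul (rmul p s) t
  torsor {x : M} (p q : P x) : ∃! s : Spin13, rmul p s = q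
  coframe {x : M} : P x → g.Coframe x
  coframe_rmul {x : M} (p : P x) (s : Spin13) (a : Fin 4 → ℝ) :
    CliffordAlgebra.ι (g.coform x) (coframe (rmul p s) a) =
      gauge (coframe p) ((s : Cl13) * CliffordAlgebra.ι minkowskiForm a * ((s⁻¹ : Spin13) : Cl13))
  index : Type w
  dom : index → Set M
  isOpen_dom (i : index) : IsOpen (dom i)
  cover (x : M) : ∃ i, x ∈ dom i
  /-- The local sections; the values of `sec i` outside `dom i` play no role. -/
  sec (i : index) (x : M) : P x
  smooth_frame (i : index) (a : Fin 4) :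
    ContMDiffOn I4 I4.tangent ∞
      (fun x => (⟨x, vec (coframe (sec i x)) a⟩ : TangentBundle I4 M)) (dom i)
  smooth_transition (i j : index) : ∃ h : M → Spin13,
    SmoothOnCl (fun x => (h x : Cl13)) (dom i ∩ dom j) ∧
      ∀ x ∈ dom i ∩ dom j, sec j x = rmul (sec i x) (h x)

namespace SpinStructure

variable (S : SpinStructure.{u, v, w} g)

lemma gauge_rmul {x : M} (p : S.P x) (s : Spin13) (a : Cl13) :
    gauge (S.coframe (S.rmul p s)) a =
      gauge (S.coframe p) ((s : Cl13) * a * ((s⁻¹ : Spin13) : Cl13)) := by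
  have hs : ((s⁻¹ : Spin13) : Cl13) * (s : Cl13) = 1 := by
    rw [← Submonoid.coe_mul, inv_mul_cancel, Submonoid.coe_one]
  have hs' : (s : Cl13) * ((s⁻¹ : Spin13) : Cl13) = 1 := by
    rw [← Submonoid.coe_mul, mul_inv_cancel, Submonoid.coe_one]
  induction a using CliffordAlgebra.induction with
  | algebraMap r =>
    rw [← Algebra.commutes, mul_assoc, hs', mul_one, AlgEquiv.commutes, AlgEquiv.commutes]
  | ι a =>
    rw [← S.coframe_rmul]
    simp [gauge]
  | mul a b ha hb =>
    rw [map_mul, ha, hb, ← map_mul]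
    congr 1
    simp only [mul_assoc]
    rw [← mul_assoc ((s⁻¹ : Spin13) : Cl13) (s : Cl13), hs, one_mul]
  | add a b ha hb => rw [map_add, ha, hb, ← map_add, mul_add, add_mul]

lemma gauge_symm_rmul {x : M} (p : S.P x) (s : Spin13) (A : g.Cl x) :
    (gauge (S.coframe (S.rmul p s))).symm A =
      ((s⁻¹ : Spin13) : Cl13) * (gauge (S.coframe p)).symm A * (s : Cl13) := by
  have hs : ((s⁻¹ : Spin13) : Cl13) * (s : Cl13) = 1 := by
    rw [← Submonoid.coe_mul, inv_mul_cancel, Submonoid.coe_one]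
  have hs' : (s : Cl13) * ((s⁻¹ : Spin13) : Cl13) = 1 := by
    rw [← Submonoid.coe_mul, mul_inv_cancel, Submonoid.coe_one]
  rw [AlgEquiv.symm_apply_eq, gauge_rmul]
  simp only [← mul_assoc]
  rw [hs', one_mul, mul_assoc, hs', mul_one, AlgEquiv.apply_symm_apply]

/-- The fibre at `x` of the left spin-Clifford bundle `P ×_ℓ ℝ_{1,3}`, `ℓ(s) a = s a`. The class
`[(p, a)]`, where `[(p s, a)] = [(p, s a)]`, is represented by the equivariant function
`P x → ℝ_{1,3}` that sends `p` to `a`. -/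
def Spinor (x : M) : Submodule ℝ (S.P x → Cl13) where
  carrier := {f | ∀ p (s : Spin13), f (S.rmul p s) = ((s⁻¹ : Spin13) : Cl13) * f p}
  add_mem' hf hf' p s := by simp [hf p s, hf' p s, mul_add]
  zero_mem' p s := by simp
  smul_mem' c f hf p s := by simp [hf p s]

/-- Left spin-Clifford fields (smoothness is imposed separately). -/
abbrev SpinorField : Type (max u v) := (x : M) → S.Spinor x

/-- The unique `s` with `p s = q`, for `p` and `q` in the same fibre. -/
def diff {x : M} (p q : S.P x) : Spin13 := (S.torsor p q).choose

lemma rmul_diff {x : M} (p q : S.P x) : S.rmul p (S.diff p q) = q :=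
  (S.torsor p q).choose_spec.1

lemma diff_eq {x : M} {p q : S.P x} {s : Spin13} (h : S.rmul p s = q) : S.diff p q = s :=
  ((S.torsor p q).choose_spec.2 s h).symm

/-- The element `[(p, a)]` of `P ×_ℓ ℝ_{1,3}`. -/
def cls {x : M} (p : S.P x) (a : Cl13) : S.Spinor x :=
  ⟨fun q => (((S.diff p q)⁻¹ : Spin13) : Cl13) * a, by
    intro q s
    have h1 : S.diff p (S.rmul q s) = S.diff p q * s :=
      S.diff_eq (by rw [S.rmul_mul, S.rmul_diff])
    show (((S.diff p (S.rmul q s))⁻¹ : Spin13) : Cl13) * a =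
      ((s⁻¹ : Spin13) : Cl13) * ((((S.diff p q)⁻¹ : Spin13) : Cl13) * a)
    rw [h1, mul_inv_rev, Submonoid.coe_mul, mul_assoc]⟩

lemma cls_apply_self {x : M} (p : S.P x) (a : Cl13) : (S.cls p a).1 p = a := by
  show (((S.diff p p)⁻¹ : Spin13) : Cl13) * a = a
  rw [S.diff_eq (S.rmul_one p), inv_one, Submonoid.coe_one, one_mul]

lemma spinor_ext {x : M} (p : S.P x) {f f' : S.Spinor x} (h : f.1 p = f'.1 p) : f = f' := by
  refine Subtype.ext (funext fun q => ?_)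
  obtain ⟨s, hs, -⟩ := S.torsor p q
  rw [← hs, f.2 p s, f'.2 p s, h]

lemma cls_rmul {x : M} (p : S.P x) (s : Spin13) (a : Cl13) :
    S.cls (S.rmul p s) a = S.cls p ((s : Cl13) * a) := by
  apply S.spinor_ext (S.rmul p s)
  rw [cls_apply_self, (S.cls p _).2 p s, cls_apply_self, ← mul_assoc, ← Submonoid.coe_mul,
    inv_mul_cancel, Submonoid.coe_one, one_mul]

/-- The action of the Clifford bundle on the left spin-Clifford bundle,
`[(p, A)] [(p, a)] = [(p, A a)]`. -/
instance (x : M) : Module (g.Cl x) (S.Spinor x) where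
  smul A f := ⟨fun p => (gauge (S.coframe p)).symm A * f.1 p, by
    intro p s
    have hs' : (s : Cl13) * ((s⁻¹ : Spin13) : Cl13) = 1 := by
      rw [← Submonoid.coe_mul, mul_inv_cancel, Submonoid.coe_one]
    show (gauge (S.coframe (S.rmul p s))).symm A * f.1 (S.rmul p s) =
      ((s⁻¹ : Spin13) : Cl13) * ((gauge (S.coframe p)).symm A * f.1 p)
    rw [gauge_symm_rmul, f.2 p s]
    simp only [mul_assoc]
    rw [← mul_assoc (s : Cl13), hs', one_mul]⟩
  one_smul f := Subtype.ext (funext fun p => by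
    show (gauge (S.coframe p)).symm 1 * f.1 p = f.1 p
    rw [map_one, one_mul])
  mul_smul A B f := Subtype.ext (funext fun p => by
    show (gauge (S.coframe p)).symm (A * B) * f.1 p =
      (gauge (S.coframe p)).symm A * ((gauge (S.coframe p)).symm B * f.1 p)
    rw [map_mul, mul_assoc])
  smul_zero A := Subtype.ext (funext fun p => by
    show (gauge (S.coframe p)).symm A * 0 = 0
    rw [mul_zero])
  smul_add A f f' := Subtype.ext (funext fun p => by
    show (gauge (S.coframe p)).symm A * (f.1 p + f'.1 p) =
      (gauge (S.coframe p)).symm A * f.1 p + (gauge (S.coframe p)).symm A * f'.1 p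
    rw [mul_add])
  add_smul A B f := Subtype.ext (funext fun p => by
    show (gauge (S.coframe p)).symm (A + B) * f.1 p =
      (gauge (S.coframe p)).symm A * f.1 p + (gauge (S.coframe p)).symm B * f.1 p
    rw [map_add, add_mul])
  zero_smul f := Subtype.ext (funext fun p => by
    show (gauge (S.coframe p)).symm 0 * f.1 p = 0
    rw [map_zero, zero_mul])

/-- Smooth Clifford fields: smooth components in the local gauges of the spin structure. -/
def SmoothClField (A : g.ClField) : Prop :=
  ∀ i, SmoothOnCl (fun x => (gauge (S.coframe (S.sec i x))).symm (A x)) (S.dom i)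

/-- Smooth left spin-Clifford fields: smooth components in the local gauges. -/
def SmoothSpinorField (ψ : S.SpinorField) : Prop :=
  ∀ i, SmoothOnCl (fun x => (ψ x).1 (S.sec i x)) (S.dom i)

end SpinStructure

/-- A spin coframe: a smooth global section `Ξ` of the principal bundle. -/
structure SpinFrame (S : SpinStructure.{u, v, w} g) where
  val (x : M) : S.P x
  smooth (i : S.index) : ∃ h : M → Spin13, SmoothOnCl (fun x => (h x : Cl13)) (S.dom i) ∧
    ∀ x ∈ S.dom i, val x = S.rmul (S.sec i x) (h x)

/-! ### Connections on the tangent bundle -/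

variable (M) in
/-- Connections on the tangent bundle of `M`. -/
abbrev Connection : Type u :=
  CovariantDerivative I4 E4 (TangentSpace I4 : M → Type)

/-- `∇ g = 0`, i.e. `v(g(Y, Z)) = g(∇_v Y, Z) + g(Y, ∇_v Z)`. -/
def MetricCompatible (g : LorentzMetric M) (nab : Connection M) : Prop :=
  ∀ (Y Z : (x : M) → TangentSpace I4 x) (x : M),
    MDifferentiableAt I4 I4.tangent (fun y => (⟨y, Y y⟩ : TangentBundle I4 M)) x →
    MDifferentiableAt I4 I4.tangent (fun y => (⟨y, Z y⟩ : TangentBundle I4 M)) x →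
    ∀ v : TangentSpace I4 x,
      mvfderiv I4 (fun y => g.val y (Y y) (Z y)) x v =
        g.val x (nab Y x v) (Z x) + g.val x (Y x) (nab Z x v)

/-- `D` is the Levi-Civita connection of `g`. -/
def IsLeviCivita (g : LorentzMetric M) (D : Connection M) : Prop :=
  MetricCompatible g D ∧ ∀ x, D.torsion x = 0

/-- The torsion operator `α ↦ ♭ τ(X, ♯α)` on covectors. -/
def torCovec (g : LorentzMetric M) (nab : Connection M) (x : M) (X : TangentSpace I4 x) : Cotangent x →ₗ[ℝ] Cotangent x :=
  (g.flat x).toLinearMap ∘ₗ (nab.torsion x X).toLinearMap ∘ₗ (g.sharp x).toLinearMap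

/-- The torsion operator `τ(X, A)` on Clifford fields: the extension of `τ(X, ·)` from vectors
(identified with covectors by the metric) to a derivation of the Clifford algebra. -/
def tau (g : LorentzMetric M) (nab : Connection M) (X : (x : M) → TangentSpace I4 x) (A : g.ClField) : g.ClField := fun x =>
  extDer (g.coform x) (torCovec g nab x (X x)) (A x)

variable {S : SpinStructure.{u, v, w} g} (Ξ : SpinFrame S) (nab : Connection M)

namespace SpinFrame

/-- The orthonormal coframe `{θ^a}` determined by `Ξ`. -/
def cof (x : M) : g.Coframe x := S.coframe (Ξ.val x)

/-- The orthonormal frame `{e_a}` dual to `{θ^a}`. -/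
def e (a : Fin 4) (x : M) : TangentSpace I4 x := vec (Ξ.cof x) a

/-- The covector fields `θ^a` as Clifford fields. -/
def theta (a : Fin 4) : g.ClField := fun x => th (Ξ.cof x) a

/-- `θ^a ∧ θ^b`. -/
def thetaWedge (a b : Fin 4) : g.ClField := fun x => wedge (Ξ.theta a x) (Ξ.theta b x)

/-- The connection coefficient `ω_{ab}^c = Γ_{ab}^c`, where `∇_{e_a} e_b = Γ_{ab}^c e_c`. -/
def Gam (a b c : Fin 4) (x : M) : ℝ := covec (Ξ.cof x) c (nab (Ξ.e b) x (Ξ.e a x))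

/-- The components of the torsion tensor, `τ(e_a, e_b) = T_{ab}^c e_c`. -/
def Tor (a b c : Fin 4) (x : M) : ℝ := covec (Ξ.cof x) c (nab.torsion x (Ξ.e a x) (Ξ.e b x))

/-- The components of the strain tensor of `∇`, defined by
`Γ_{ab}^c = Γ̊_{ab}^c + ½ T_{ab}^c + ½ S_{ab}^c`, with `Γ̊` the coefficients of `D`. -/
def Strain (D : Connection M) (a b c : Fin 4) (x : M) : ℝ :=
  2 * (Ξ.Gam nab a b c x - Ξ.Gam D a b c x - (1 / 2) * Ξ.Tor nab a b c x)

/-! ### Covariant derivatives of Clifford and spin-Clifford fields -/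

/-- The zeroth order part of the covariant derivative of covector fields in the coframe:
`θ^b ↦ ∇_X θ^b = -θ^b(∇_X e_c) θ^c`. -/
def covecConn (x : M) (X : TangentSpace I4 x) : Cotangent x →ₗ[ℝ] Cotangent x where
  toFun α := -∑ c, α (nab (Ξ.e c) x X) • covec (Ξ.cof x) c
  map_add' α β := by
    simp only [LinearMap.add_apply, add_smul, Finset.sum_add_distrib, neg_add]
  map_smul' r α := by
    simp only [LinearMap.smul_apply, smul_assoc, RingHom.id_apply, smul_neg, Finset.smul_sum]

/-- The Pfaff derivative `∂_X A = X(A^I) θ_I` of a Clifford field `A = A^I θ_I`. -/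
def pfaff (A : g.ClField) (x : M) (X : TangentSpace I4 x) : g.Cl x :=
  gauge (Ξ.cof x) (clDeriv (fun y => (gauge (Ξ.cof y)).symm (A y)) x X)

/-- The covariant derivative `∇_X A` of a Clifford field, induced by `∇`: if `A = A^I θ_I`, then
`∇_X A = X(A^I) θ_I + A^I ∇_X θ_I`, where `∇_X` acts on the products `θ_I` as a derivation. -/
def nabCl (X : (x : M) → TangentSpace I4 x) (A : g.ClField) : g.ClField := fun x =>
  Ξ.pfaff A x (X x) + extDer (g.coform x) (Ξ.covecConn nab x (X x)) (A x)

/-- The biform-valued connection form in the gauge `Ξ`, evaluated at `X`: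
`ω_X = ½ ω_X^{ab} θ_a ∧ θ_b`, where `ω_X^{ab} = η^{bc} θ^a(∇_X e_c)`. -/
def omega (X : (x : M) → TangentSpace I4 x) : g.ClField := fun x =>
  (1 / 2 : ℝ) • ∑ a, ∑ b, (∑ c, eta b c * covec (Ξ.cof x) a (nab (Ξ.e c) x (X x))) •
    wedge (thLow (Ξ.cof x) a) (thLow (Ξ.cof x) b)

/-- The Pfaff derivative of a left spin-Clifford field in the gauge `Ξ`:
if `ψ = [(Ξ, f)]`, then `∂_X ψ = [(Ξ, X(f))]`. -/
def pfaffSpin (ψ : S.SpinorField) (x : M) (X : TangentSpace I4 x) : S.Spinor x :=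
  S.cls (Ξ.val x) (clDeriv (fun y => (ψ y).1 (Ξ.val y)) x X)

/-- The spinor covariant derivative `∇ˢ_X ψ = ∂_X ψ + ½ ω_X ψ`. -/
def nabSpin (X : (x : M) → TangentSpace I4 x) (ψ : S.SpinorField) : S.SpinorField := fun x =>
  Ξ.pfaffSpin ψ x (X x) + (1 / 2 : ℝ) • (Ξ.omega nab X x • ψ x)

/-- The unit section `1^ℓ_Ξ = [(Ξ, 1)]` of the left spin-Clifford bundle. -/
def unitSection : S.SpinorField := fun x => S.cls (Ξ.val x) 1

/-! ### Dirac operators -/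

/-- The Dirac operator `θ^a ∇_{e_a}` on Clifford fields. For the Levi-Civita connection it is the
standard Dirac operator. -/
def dirac (A : g.ClField) : g.ClField := ∑ a, Ξ.theta a * Ξ.nabCl nab (Ξ.e a) A

/-- The spin-Dirac operator `θ^a ∇ˢ_{e_a}` on left spin-Clifford fields. -/
def spinDirac (ψ : S.SpinorField) : S.SpinorField := fun x =>
  ∑ a, Ξ.theta a x • Ξ.nabSpin nab (Ξ.e a) ψ x

/-- The operators `S₁ = (S₁)_{ab}`. -/
def S1 (D : Connection M) (a b : Fin 4) (A : g.ClField) : g.ClField := fun x =>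
  (1 / 2 : ℝ) • tau g nab (Ξ.e a) (Ξ.nabCl D (Ξ.e b) A) x
    + (1 / 2 : ℝ) • Ξ.nabCl D (Ξ.e a) (tau g nab (Ξ.e b) A) x
    - (1 / 2 : ℝ) • ∑ c, Ξ.Tor nab a b c x • Ξ.nabCl D (Ξ.e c) A x
    - (1 / 2 : ℝ) • ∑ c, Ξ.Gam D a b c x • tau g nab (Ξ.e c) A x
    + (1 / 4 : ℝ) • tau g nab (Ξ.e a) (tau g nab (Ξ.e b) A) x
    - (1 / 4 : ℝ) • ∑ c, Ξ.Tor nab a b c x • tau g nab (Ξ.e c) A x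

/-- The operators `S₂ = (S₂)_{ab}`. -/
def S2 (a b : Fin 4) (A : g.ClField) : g.ClField := fun x =>
  (1 / 2 : ℝ) • (Ξ.nabCl nab (Ξ.e b) A x * Ξ.omega nab (Ξ.e a) x)
    + (1 / 2 : ℝ) • (Ξ.nabCl nab (Ξ.e a) A x * Ξ.omega nab (Ξ.e b) x)
    + (1 / 2 : ℝ) • (A x * Ξ.nabCl nab (Ξ.e a) (Ξ.omega nab (Ξ.e b)) x)
    + (1 / 4 : ℝ) • (A x * Ξ.omega nab (Ξ.e b) x * Ξ.omega nab (Ξ.e a) x)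
    - (1 / 2 : ℝ) • ∑ c, Ξ.Gam nab a b c x • (A x * Ξ.omega nab (Ξ.e c) x)

/-- `A 1^ℓ_Ξ`. -/
def onUnit (A : g.ClField) : S.SpinorField := fun x => A x • Ξ.unitSection x

end SpinFrame

end RiemannCartan

end

namespace RiemannCartan

section

/-! ### Clifford algebras: exterior product of vectors and inner derivations -/

section Clifford

variable {V : Type*} [AddCommGroup V] [Module ℝ V] {Q : QuadraticForm ℝ V}

/-! The section `Ξ` trivialises both bundles, so a spinor field is `A 1^ℓ_Ξ` with a unique `A`, and
the operators can be compared on `A`. Metric compatibility makes the connection coefficients skew,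
hence the zeroth order part of `∇_X` on Clifford fields is the inner derivation `½[ω_X, ·]`
(`omega_commutator_ι`, `nabCl_eq`). Since `½ω_X A = ½[ω_X, A] + ½Aω_X`, the spinor derivative of `A
1^ℓ_Ξ` is `(∇_X A + ½Aω_X) 1^ℓ_Ξ` (`nabSpin_onUnit`): the two derivatives differ by a right
multiplication.

Differentiating `θ^b B_b` once more, with `∇_{e_a}θ^b = -Γ_{ac}^b θ^c`, gives `θ^aθ^b(∇_a B_b -
Γ_{ab}^c B_c)` (`sum_theta_mul_nabCl_sum`). For `B_b = ∇_b A` this is the square of the Dirac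
operator; for `B_b = ∇_b A + ½Aω_b`, together with the right multiplication `½B_b ω_a`, the
additional terms are `S₂`. The splitting `θ^aθ^b = η^{ab} + θ^a ∧ θ^b` produces the two sums
(`eta_add_thetaWedge`).

If the strain vanishes, then `τ(e_a, ·)` is twice the difference of `∇` and `D` along `e_a`
(`torCovec_eq`), so `∇_a = D_a + ½τ(e_a, ·)` on Clifford fields (`nabCl_eq_add_tau`). Substitution
into the square of the Dirac operator leaves exactly `S₁` besides the standard square. -/

lemma wedge_ι_ι (a b : V) :
    wedge (CliffordAlgebra.ι Q a) (CliffordAlgebra.ι Q b) =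
      CliffordAlgebra.ι Q a * CliffordAlgebra.ι Q b
        - algebraMap ℝ _ ((1 / 2) * QuadraticMap.polar Q a b) := by
  -- On the exterior side the image of `ι a * ι b` is the exterior product plus half the polar form,
  -- which the subtracted scalar cancels.
  have key : CliffordAlgebra.equivExterior Q
      (CliffordAlgebra.ι Q a * CliffordAlgebra.ι Q b
        - algebraMap ℝ _ ((1 / 2) * QuadraticMap.polar Q a b)) =
      CliffordAlgebra.equivExterior Q (CliffordAlgebra.ι Q a) *
        CliffordAlgebra.equivExterior Q (CliffordAlgebra.ι Q b) := by
    rw [map_sub]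
    simp only [CliffordAlgebra.equivExterior, CliffordAlgebra.changeFormEquiv_apply,
      CliffordAlgebra.changeForm_ι_mul_ι, CliffordAlgebra.changeForm_algebraMap,
      CliffordAlgebra.changeForm_ι]
    rw [QuadraticMap.associated_apply, sub_sub, ← map_add, sub_eq_self]
    simp only [QuadraticMap.polar, neg_apply]
    rw [← map_zero (algebraMap ℝ (CliffordAlgebra (0 : QuadraticForm ℝ V)))]
    congr 1
    -- The associated bilinear form carries its factor `⅟2` in the endomorphism ring of `ℝ`; it acts
    -- as the number `1/2`.
    have half : ∀ r : ℝ, (⅟2 : Module.End ℝ ℝ) • r = (1 / 2) * r := fun r => by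
      have h : (2 : Module.End ℝ ℝ) ((⅟2 : Module.End ℝ ℝ) r) = r := by
        rw [← Module.End.mul_apply, mul_invOf_self, Module.End.one_apply]
      rw [Module.End.ofNat_apply, ofNat_smul_eq_nsmul, nsmul_eq_mul] at h
      rw [Module.End.smul_def]
      push_cast at h
      linarith
    rw [half]
    ring
  rw [wedge, ← key, LinearEquiv.symm_apply_apply]

lemma extDer_add {T : V →ₗ[ℝ] V} (A B : CliffordAlgebra Q) :
    extDer Q T (A + B) = extDer Q T A + extDer Q T B := by
  unfold extDer
  split_ifs <;> simp

lemma extDer_algebraMap {T : V →ₗ[ℝ] V} (r : ℝ) :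
    extDer Q T (algebraMap ℝ (CliffordAlgebra Q) r) = 0 := by
  unfold extDer
  split_ifs
  · rw [AlgHom.commutes, TrivSqZeroExt.algebraMap_eq_inl', TrivSqZeroExt.snd_inl]
  · rfl

/-- If `½[w, ·]` agrees with the skew-adjoint `T` on vectors, then it is the derivation that
extends `T`. -/
lemma extDer_eq_commutator {T : V →ₗ[ℝ] V} (h : IsSkew Q T) {w : CliffordAlgebra Q}
    (hw : ∀ v, (1 / 2 : ℝ) • (w * CliffordAlgebra.ι Q v - CliffordAlgebra.ι Q v * w) =
      CliffordAlgebra.ι Q (T v)) (A : CliffordAlgebra Q) :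
    extDer Q T A = (1 / 2 : ℝ) • (w * A - A * w) := by
  -- Both sides are derivations that kill the scalars, so agreement on vectors is enough.
  induction A using CliffordAlgebra.induction with
  | algebraMap r => rw [extDer_algebraMap, Algebra.commutes, sub_self, smul_zero]
  | ι v => rw [extDer_ι h, hw]
  | mul a b ha hb =>
    rw [extDer_mul h, ha, hb, smul_mul_assoc, mul_smul_comm, ← smul_add]
    congr 1
    noncomm_ring
  | add a b ha hb =>
    rw [extDer_add, ha, hb, ← smul_add]
    congr 1
    noncomm_ring

end Clifford

/-! ### Minkowski form, musical isomorphisms and orthonormal coframes -/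

lemma minkowskiForm_polar (p q : Fin 4 → ℝ) :
    QuadraticMap.polar minkowskiForm p q = 2 * ∑ a, eta a a * (p a * q a) := by
  simp only [QuadraticMap.polar, minkowskiForm, QuadraticMap.weightedSumSquares_apply,
    Pi.add_apply, smul_eq_mul, ← Finset.sum_sub_distrib, Finset.mul_sum]
  exact Finset.sum_congr rfl fun a _ => by ring

lemma eta_ne {a b : Fin 4} (h : a ≠ b) : eta a b = 0 := if_neg h

lemma eta_sq (a : Fin 4) : eta a a * eta a a = 1 := by
  simp only [eta, if_true]
  split_ifs <;> norm_num

lemma sum_eta_smul {E : Type*} [AddCommGroup E] [Module ℝ E] (a : Fin 4) (f : Fin 4 → E) :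
    ∑ b, eta a b • f b = eta a a • f a :=
  Finset.sum_eq_single a (fun b _ hb => by rw [eta_ne (Ne.symm hb), zero_smul]) (by simp)

lemma sum_eta_mul (a : Fin 4) (f : Fin 4 → ℝ) : ∑ b, eta a b * f b = eta a a * f a :=
  sum_eta_smul a f

variable {M : Type u} [TopologicalSpace M] [ChartedSpace E4 M] [IsManifold I4 ∞ M]
variable {g : LorentzMetric M}

lemma flat_apply {x : M} (a b : TangentSpace I4 x) : g.flat x a b = g.val x a b := rfl

lemma val_sharp {x : M} (α : Cotangent x) (b : TangentSpace I4 x) :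
    g.val x (g.sharp x α) b = α b := by
  rw [← flat_apply, LorentzMetric.sharp, LinearEquiv.apply_symm_apply]

lemma coform_polar {x : M} (α β : Cotangent x) :
    QuadraticMap.polar (g.coform x) α β = 2 * α (g.sharp x β) := by
  have h : ∀ γ, g.coform x γ = g.val x (g.sharp x γ) (g.sharp x γ) := fun _ => rfl
  simp only [QuadraticMap.polar, h, map_add, add_apply, val_sharp]
  rw [← val_sharp (g := g) β (g.sharp x α), g.symm, val_sharp]
  ring

section Coframe

variable {x : M} (F : g.Coframe x)

lemma coframe_polar (p q : Fin 4 → ℝ) :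
    QuadraticMap.polar (g.coform x) (F p) (F q) = 2 * ∑ a, eta a a * (p a * q a) := by
  rw [← minkowskiForm_polar]
  simp only [QuadraticMap.polar, ← map_add, QuadraticMap.IsometryEquiv.map_app]

lemma covec_polar (a b : Fin 4) :
    QuadraticMap.polar (g.coform x) (covec F a) (covec F b) = 2 * eta a b := by
  rw [covec, covec, coframe_polar]
  by_cases h : a = b
  · subst h
    simp [Pi.single_apply]
  · rw [eta_ne h, Finset.sum_eq_zero]
    · intro c _
      simp only [Pi.single_apply]
      split_ifs <;> simp_all

lemma covec_sharp_covec (a b : Fin 4) : covec F a (g.sharp x (covec F b)) = eta a b := by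
  have := coform_polar (g := g) (covec F a) (covec F b)
  rw [covec_polar] at this
  linarith

lemma vec_eq (a : Fin 4) : vec F a = eta a a • g.sharp x (covec F a) := sum_eta_smul _ _

lemma thLow_eq (a : Fin 4) : thLow F a = eta a a • th F a := sum_eta_smul _ _

lemma sharp_covec (a : Fin 4) : g.sharp x (covec F a) = eta a a • vec F a := by
  rw [vec_eq, smul_smul, eta_sq, one_smul]

lemma covec_vec (a b : Fin 4) : covec F a (vec F b) = if a = b then 1 else 0 := by
  rw [vec_eq, map_smul, covec_sharp_covec, smul_eq_mul]
  split_ifs with h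
  · rw [h, eta_sq]
  · rw [eta_ne h, mul_zero]

lemma covec_apply (a : Fin 4) (X : TangentSpace I4 x) :
    covec F a X = eta a a * g.val x (vec F a) X := by
  rw [vec_eq, map_smul, smul_apply, val_sharp, smul_eq_mul, ← mul_assoc, eta_sq, one_mul]

lemma coframe_apply (p : Fin 4 → ℝ) : F p = ∑ a, p a • covec F a := by
  conv_lhs => rw [← (Pi.basisFun ℝ (Fin 4)).sum_repr p]
  have : ∀ q, F q = F.toLinearEquiv q := fun _ => rfl
  simp only [covec, this, map_sum, map_smul, Pi.basisFun_repr, Pi.basisFun_apply]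

lemma sum_apply_vec_smul_covec (α : Cotangent x) : ∑ a, α (vec F a) • covec F a = α := by
  obtain ⟨p, rfl⟩ : ∃ p, F p = α := F.toLinearEquiv.surjective α
  simp only [coframe_apply F p, covec_vec, smul_eq_mul, mul_ite, mul_one, mul_zero,
    Finset.sum_ite_eq', LinearMap.sum_apply, LinearMap.smul_apply, Finset.mem_univ, if_true]

lemma th_mul_th_add (a b : Fin 4) :
    th F a * th F b + th F b * th F a = algebraMap ℝ _ (2 * eta a b) := by
  rw [th, th, CliffordAlgebra.ι_mul_ι_add_swap, covec_polar]

/-- The scalar and bivector parts of `θ^aθ^b`; this is where the two sums of the theorem come from.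
-/
lemma wedge_th (a b : Fin 4) :
    wedge (th F a) (th F b) = th F a * th F b - algebraMap ℝ _ (eta a b) := by
  rw [th, th, wedge_ι_ι, covec_polar]
  congr 2
  ring

lemma gauge_ι (p : Fin 4 → ℝ) :
    gauge F (CliffordAlgebra.ι minkowskiForm p) = CliffordAlgebra.ι (g.coform x) (F p) := by
  simp [gauge]

lemma gauge_symm_th (a : Fin 4) :
    (gauge F).symm (th F a) = CliffordAlgebra.ι minkowskiForm (Pi.single a 1) := by
  rw [AlgEquiv.symm_apply_eq, gauge_ι]; rfl

end Coframe

end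

section

variable {M : Type u} [TopologicalSpace M] [ChartedSpace E4 M]

/-! ### Calculus of functions with values in the spacetime algebra -/

section Calculus

lemma smoothOnCl_sum {ι : Type*} {s : Finset ι} {φ : ι → M → ℝ} {U : Set M}
    (hφ : ∀ i ∈ s, ContMDiffOn I4 𝓘(ℝ, ℝ) ∞ (φ i) U) (c : ι → Cl13) :
    SmoothOnCl (fun x => ∑ i ∈ s, φ i x • c i) U := by
  intro J
  have : (fun x => clBasis.repr (∑ i ∈ s, φ i x • c i) J) =
      fun x => ∑ i ∈ s, φ i x * clBasis.repr (c i) J := by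
    ext x
    simp only [map_sum, map_smul, Finsupp.coe_finsetSum, Finset.sum_apply, Finsupp.smul_apply,
      smul_eq_mul]
  rw [this]
  exact contMDiffOn_finsetSum fun i hi => (hφ i hi).mul contMDiffOn_const

lemma eq_sum_repr (a : Cl13) : a = ∑ J, clBasis.repr a J • clBasis J := (clBasis.sum_repr a).symm

lemma SmoothOnCl.congr {f f' : M → Cl13} {U : Set M} (hf : SmoothOnCl f U)
    (h : ∀ x ∈ U, f' x = f x) : SmoothOnCl f' U :=
  fun J => (hf J).congr fun x hx => by rw [h x hx]

lemma smoothOnCl_const (c : Cl13) (U : Set M) : SmoothOnCl (fun _ => c) U :=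
  fun _ => contMDiffOn_const

lemma SmoothOnCl.add {f f' : M → Cl13} {U : Set M} (hf : SmoothOnCl f U)
    (hf' : SmoothOnCl f' U) : SmoothOnCl (fun x => f x + f' x) U := fun J => by
  simp only [map_add, Finsupp.add_apply]
  exact (hf J).add (hf' J)

lemma SmoothOnCl.map (L : Cl13 →ₗ[ℝ] Cl13) {f : M → Cl13} {U : Set M} (hf : SmoothOnCl f U) :
    SmoothOnCl (fun x => L (f x)) U :=
  (smoothOnCl_sum (s := Finset.univ) (fun J _ => hf J) fun J => L (clBasis J)).congr fun x _ => by
    conv_lhs => rw [eq_sum_repr (f x)]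
    simp only [map_sum, map_smul]

lemma SmoothOnCl.functional (φ : Cl13 →ₗ[ℝ] ℝ) {f : M → Cl13} {U : Set M}
    (hf : SmoothOnCl f U) : ContMDiffOn I4 𝓘(ℝ, ℝ) ∞ (fun x => φ (f x)) U := by
  have : (fun x => φ (f x)) = fun x => ∑ J, clBasis.repr (f x) J * φ (clBasis J) := by
    ext x
    conv_lhs => rw [eq_sum_repr (f x)]
    simp only [map_sum, map_smul, smul_eq_mul]
  rw [this]
  exact contMDiffOn_finsetSum fun J _ => (hf J).mul contMDiffOn_const

/-- Expansion by structure constants: it reduces smoothness and the Leibniz rule for products in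
`ℝ_{1,3}` to real functions. -/
lemma mul_eq_sum_repr (a b : Cl13) : a * b = ∑ I : Finset (Fin 4) × Finset (Fin 4),
    (clBasis.repr a I.1 * clBasis.repr b I.2) • (clBasis I.1 * clBasis I.2) := by
  conv_lhs => rw [eq_sum_repr a, eq_sum_repr b]
  rw [Finset.sum_mul_sum, ← Finset.sum_product', Finset.univ_product_univ]
  exact Finset.sum_congr rfl fun I _ => smul_mul_smul_comm _ _ _ _

lemma SmoothOnCl.mul {f f' : M → Cl13} {U : Set M} (hf : SmoothOnCl f U)
    (hf' : SmoothOnCl f' U) : SmoothOnCl (fun x => f x * f' x) U :=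
  (smoothOnCl_sum (fun I _ => (hf I.1).mul (hf' I.2)) _).congr fun _ _ => mul_eq_sum_repr _ _

lemma SmoothOnCl.smul {φ : M → ℝ} {f : M → Cl13} {U : Set M}
    (hφ : ContMDiffOn I4 𝓘(ℝ, ℝ) ∞ φ U) (hf : SmoothOnCl f U) :
    SmoothOnCl (fun x => φ x • f x) U := fun J => by
  simp only [map_smul, Finsupp.smul_apply, smul_eq_mul]
  exact hφ.mul (hf J)

lemma SmoothOnCl.sum {ι : Type*} {s : Finset ι} {f : ι → M → Cl13} {U : Set M}
    (hf : ∀ i ∈ s, SmoothOnCl (f i) U) : SmoothOnCl (fun x => ∑ i ∈ s, f i x) U := by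
  induction s using Finset.cons_induction with
  | empty => simpa using smoothOnCl_const 0 U
  | cons i s hi ih =>
    simp only [Finset.sum_cons]
    exact (hf i (by simp)).add (ih fun j hj => hf j (by simp [hj]))

lemma SmoothOnCl.mdifferentiableAt {f : M → Cl13} (hf : SmoothOnCl f Set.univ) (x : M)
    (J : Finset (Fin 4)) : MDifferentiableAt I4 𝓘(ℝ, ℝ) (fun y => clBasis.repr (f y) J) x :=
  (contMDiffOn_univ.1 (hf J)).contMDiffAt.mdifferentiableAt (by simp)

/-- Both claims are proved in one induction, because the derivative of the sum requires
differentiability of the remaining terms. -/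
lemma mvfderiv_sum_mul {ι : Type*} (s : Finset ι) {φ : ι → M → ℝ} {x : M}
    (hφ : ∀ i ∈ s, MDifferentiableAt I4 𝓘(ℝ, ℝ) (φ i) x) (c : ι → ℝ) (X : TangentSpace I4 x) :
    MDifferentiableAt I4 𝓘(ℝ, ℝ) (fun y => ∑ i ∈ s, φ i y * c i) x ∧
    mvfderiv I4 (fun y => ∑ i ∈ s, φ i y * c i) x X = ∑ i ∈ s, mvfderiv I4 (φ i) x X * c i := by
  induction s using Finset.cons_induction with
  | empty =>
    simp only [Finset.sum_empty]
    exact ⟨mdifferentiableAt_const, by rw [mvfderiv_const]; rfl⟩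
  | cons i s hi ih =>
    obtain ⟨h1, h2⟩ := ih fun j hj => hφ j (by simp [hj])
    have h3 : MDifferentiableAt I4 𝓘(ℝ, ℝ) (fun y => φ i y * c i) x :=
      (hφ i (by simp)).mul mdifferentiableAt_const
    simp only [Finset.sum_cons]
    refine ⟨h3.add h1, ?_⟩
    have h4 := mvfderiv_add h3 h1
    have h5 := mvfderiv_mul (hφ i (by simp)) (mdifferentiableAt_const (c := c i) (I := I4))
    rw [mvfderiv_const, smul_zero, zero_add] at h5
    have h6 := DFunLike.congr_fun h4 X
    rw [add_apply, h2] at h6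
    refine h6.trans ?_
    congr 1
    refine (DFunLike.congr_fun h5 X).trans ?_
    rw [smul_apply, smul_eq_mul, mul_comm]

/-- Frees the componentwise derivative from the chosen basis: any finite expansion with constant
coefficients may be differentiated termwise. -/
lemma clDeriv_sum {ι : Type*} (s : Finset ι) {φ : ι → M → ℝ} {x : M}
    (hφ : ∀ i ∈ s, MDifferentiableAt I4 𝓘(ℝ, ℝ) (φ i) x) (c : ι → Cl13) (X : TangentSpace I4 x) :
    clDeriv (fun y => ∑ i ∈ s, φ i y • c i) x X = ∑ i ∈ s, mvfderiv I4 (φ i) x X • c i := by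
  have (J : Finset (Fin 4)) : (fun x => clBasis.repr (∑ i ∈ s, φ i x • c i) J) =
      fun x => ∑ i ∈ s, φ i x * clBasis.repr (c i) J := by
    ext x
    simp only [map_sum, map_smul, Finsupp.coe_finsetSum, Finset.sum_apply, Finsupp.smul_apply,
      smul_eq_mul]
  simp only [clDeriv, this, (mvfderiv_sum_mul s hφ _ X).2, Finset.sum_smul]
  rw [Finset.sum_comm]
  refine Finset.sum_congr rfl fun i _ => ?_
  conv_rhs => rw [eq_sum_repr (c i)]
  simp only [Finset.smul_sum, smul_smul]

lemma clDeriv_const (c : Cl13) (x : M) (X : TangentSpace I4 x) : clDeriv (fun _ => c) x X = 0 := by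
  simp [clDeriv, mvfderiv_const]

lemma clDeriv_add {f f' : M → Cl13} (hf : SmoothOnCl f Set.univ) (hf' : SmoothOnCl f' Set.univ)
    (x : M) (X : TangentSpace I4 x) :
    clDeriv (fun y => f y + f' y) x X = clDeriv f x X + clDeriv f' x X := by
  simp only [clDeriv, ← Finset.sum_add_distrib, ← add_smul]
  refine Finset.sum_congr rfl fun J _ => ?_
  congr 1
  have h := mvfderiv_add (hf.mdifferentiableAt x J) (hf'.mdifferentiableAt x J)
  rw [← add_apply, ← h]
  simp only [map_add, Finsupp.add_apply]
  rfl

lemma clDeriv_mul {f f' : M → Cl13} (hf : SmoothOnCl f Set.univ) (hf' : SmoothOnCl f' Set.univ)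
    (x : M) (X : TangentSpace I4 x) :
    clDeriv (fun y => f y * f' y) x X = clDeriv f x X * f' x + f x * clDeriv f' x X := by
  have h := clDeriv_sum (M := M) Finset.univ (x := x)
    (φ := fun (I : Finset (Fin 4) × Finset (Fin 4)) y =>
      clBasis.repr (f y) I.1 * clBasis.repr (f' y) I.2)
    (fun I _ => (hf.mdifferentiableAt x I.1).mul (hf'.mdifferentiableAt x I.2))
    (fun I => clBasis I.1 * clBasis I.2) X
  rw [funext fun y => mul_eq_sum_repr (f y) (f' y), h]
  have h2 (I : Finset (Fin 4) × Finset (Fin 4)) :=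
    DFunLike.congr_fun (mvfderiv_mul (hf.mdifferentiableAt x I.1) (hf'.mdifferentiableAt x I.2)) X
  have h3 (I : Finset (Fin 4) × Finset (Fin 4)) : mvfderiv I4 (fun y =>
      clBasis.repr (f y) I.1 * clBasis.repr (f' y) I.2) x X = _ := h2 I
  simp only [h3, clDeriv]
  conv_rhs => rw [eq_sum_repr (f x), eq_sum_repr (f' x)]
  simp only [Finset.sum_mul_sum, ← Finset.sum_product', Finset.univ_product_univ,
    ← Finset.sum_add_distrib, smul_mul_smul_comm, ← add_smul, add_apply, smul_apply, smul_eq_mul]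
  exact Finset.sum_congr rfl fun I _ => by congr 1; ring

end Calculus

end

/-! ### Smoothness of the orthonormal frame and skewness of the connection coefficients -/

section

/-- The vector part of an element of the spacetime algebra. -/
noncomputable def vectorPart : Cl13 →ₗ[ℝ] (Fin 4 → ℝ) :=
  ExteriorAlgebra.ιInv ∘ₗ (CliffordAlgebra.equivExterior minkowskiForm).toLinearMap

lemma vectorPart_ι (p : Fin 4 → ℝ) : vectorPart (CliffordAlgebra.ι minkowskiForm p) = p := by
  have : CliffordAlgebra.equivExterior minkowskiForm (CliffordAlgebra.ι minkowskiForm p) =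
      ExteriorAlgebra.ι ℝ p := by
    simp only [CliffordAlgebra.equivExterior, CliffordAlgebra.changeFormEquiv_apply,
      CliffordAlgebra.changeForm_ι]
  rw [vectorPart, LinearMap.comp_apply, LinearEquiv.coe_coe, this, ExteriorAlgebra.ι_leftInverse]

variable {M : Type u} [TopologicalSpace M] [ChartedSpace E4 M]

/-- In the spin group the inverse is reversion composed with grade involution, which is a linear
map. -/
lemma SmoothOnCl.spin_inv {h : M → Spin13} {U : Set M}
    (hh : SmoothOnCl (fun x => (h x : Cl13)) U) :
    SmoothOnCl (fun x => (((h x)⁻¹ : Spin13) : Cl13)) U :=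
  hh.map (CliffordAlgebra.reverse ∘ₗ CliffordAlgebra.involute.toLinearMap)

variable [IsManifold I4 ∞ M]
variable {g : LorentzMetric M} {S : SpinStructure.{u, v, w} g} (Ξ : SpinFrame S)

/-- Equivariance is given as an equation in the Clifford algebra; taking vector parts turns it into
one between covectors, with coefficients depending smoothly on `s`. -/
lemma SpinStructure.coframe_rmul_eq {x : M} (p : S.P x) (s : Spin13) (a : Fin 4 → ℝ) :
    S.coframe (S.rmul p s) a = S.coframe p (vectorPart
      ((s : Cl13) * CliffordAlgebra.ι minkowskiForm a * ((s⁻¹ : Spin13) : Cl13))) := by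
  obtain ⟨b, hb⟩ : ∃ b, S.coframe p b = S.coframe (S.rmul p s) a :=
    (S.coframe p).toLinearEquiv.surjective _
  have h := S.coframe_rmul p s a
  rw [← hb, ← gauge_ι] at h
  rw [← (gauge (S.coframe p)).injective h, vectorPart_ι, hb]

lemma SpinStructure.vec_coframe_rmul {x : M} (p : S.P x) (s : Spin13) (a : Fin 4) :
    vec (S.coframe (S.rmul p s)) a = ∑ b, (eta a a * eta b b * vectorPart
      ((s : Cl13) * CliffordAlgebra.ι minkowskiForm (Pi.single a 1) *
        ((s⁻¹ : Spin13) : Cl13)) b) • vec (S.coframe p) b := by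
  rw [vec_eq, covec, S.coframe_rmul_eq, coframe_apply, map_sum, Finset.smul_sum]
  refine Finset.sum_congr rfl fun b _ => ?_
  rw [map_smul, sharp_covec, smul_smul, smul_smul]
  congr 1
  ring

namespace SpinFrame

/-- Locally `Ξ` is a local section moved by a smooth `Spin13`-valued function, so `e_a` is a
combination of the smooth local frame with smooth coefficients. -/
lemma contMDiff_e (a : Fin 4) :
    ContMDiff I4 I4.tangent ∞ (fun x => (⟨x, Ξ.e a x⟩ : TangentBundle I4 M)) := by
  intro x
  obtain ⟨i, hi⟩ := S.cover x
  obtain ⟨h, hh, hΞ⟩ := Ξ.smooth i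
  refine ContMDiffOn.contMDiffAt ?_ ((S.isOpen_dom i).mem_nhds hi)
  have hc (b : Fin 4) : ContMDiffOn I4 𝓘(ℝ, ℝ) ∞ (fun x => eta a a * eta b b * vectorPart
      ((h x : Cl13) * CliffordAlgebra.ι minkowskiForm (Pi.single a 1) *
        (((h x)⁻¹ : Spin13) : Cl13)) b) (S.dom i) :=
    contMDiffOn_const.mul
      (((hh.mul (smoothOnCl_const _ _)).mul hh.spin_inv).functional (LinearMap.proj b ∘ₗ vectorPart))
  have key := ContMDiffOn.sum_section (s := Finset.univ)
    fun b _ => (hc b).smul_section (S.smooth_frame i b)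
  refine key.congr fun y hy => ?_
  simp only [e, cof, hΞ y hy, S.vec_coframe_rmul]
  rfl

end SpinFrame

lemma LorentzMetric.contMDiff_apply {Y Z : (x : M) → TangentSpace I4 x}
    (hY : ContMDiff I4 I4.tangent ∞ (fun x => (⟨x, Y x⟩ : TangentBundle I4 M)))
    (hZ : ContMDiff I4 I4.tangent ∞ (fun x => (⟨x, Z x⟩ : TangentBundle I4 M))) :
    ContMDiff I4 𝓘(ℝ, ℝ) ∞ (fun x => g.val x (Y x) (Z x)) := by
  have : ContMDiff I4 (I4.prod 𝓘(ℝ)) ∞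
      (fun m ↦ Bundle.TotalSpace.mk' ℝ (E := Bundle.Trivial M ℝ) m (g.val m (Y m) (Z m))) := by
    apply ContMDiff.clm_bundle_apply₂ (F₁ := E4) (F₂ := E4)
    · exact g.contMDiff
    · exact hY
    · exact hZ
  intro x
  have h := this x
  simp only [Bundle.contMDiffAt_totalSpace] at h
  exact h.2

/-- The derivative of `f` along `Y` is the fibre component of the tangent map of `f` composed with
the section `Y`. -/
lemma contMDiff_mvfderiv_apply {f : M → ℝ} (hf : ContMDiff I4 𝓘(ℝ, ℝ) ∞ f)
    {Y : (x : M) → TangentSpace I4 x}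
    (hY : ContMDiff I4 I4.tangent ∞ (fun x => (⟨x, Y x⟩ : TangentBundle I4 M))) :
    ContMDiff I4 𝓘(ℝ, ℝ) ∞ (fun x => mvfderiv I4 f x (Y x)) :=
  haveI : IsManifold I4 1 M := IsManifold.of_le (n := ∞) (by simp)
  contMDiff_snd_tangentBundle_modelSpace ℝ 𝓘(ℝ, ℝ) |>.comp
    ((hf.contMDiff_tangentMap (m := ∞) (by simp)).comp hY)

lemma contMDiff_connection (nab : Connection M)
    [CovariantDerivative.ContMDiffCovariantDerivative nab ∞]
    {Y X : (x : M) → TangentSpace I4 x}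
    (hY : ContMDiff I4 I4.tangent ∞ (fun x => (⟨x, Y x⟩ : TangentBundle I4 M)))
    (hX : ContMDiff I4 I4.tangent ∞ (fun x => (⟨x, X x⟩ : TangentBundle I4 M))) :
    ContMDiff I4 I4.tangent ∞ (fun x => (⟨x, nab Y x (X x)⟩ : TangentBundle I4 M)) := by
  have h := (CovariantDerivative.ContMDiffCovariantDerivative.contMDiff
    (cov := nab) (k := ∞)).contMDiff (σ := Y) (by simpa using contMDiffOn_univ.2 hY)
  exact ContMDiff.clm_bundle_apply (F₁ := E4) (F₂ := E4) (contMDiffOn_univ.1 h) hX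

namespace SpinFrame

lemma Gam_eq (nab : Connection M) (a b c : Fin 4) (x : M) :
    Ξ.Gam nab a b c x = eta c c * g.val x (Ξ.e c x) (nab (Ξ.e b) x (Ξ.e a x)) :=
  covec_apply _ _ _

lemma val_e_e (a b : Fin 4) (x : M) : g.val x (Ξ.e a x) (Ξ.e b x) = eta a b := by
  have h := covec_apply (Ξ.cof x) a (Ξ.e b x)
  rw [e, covec_vec] at h
  rw [e, e, ← one_mul (g.val x _ _), ← eta_sq a, mul_assoc, ← h]
  split_ifs with hab
  · rw [hab, mul_one]
  · rw [eta_ne hab, mul_zero]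

/-- The functions `g(e_b, e_c)` are constant, so compatibility with the metric becomes antisymmetry.
This is the form in which that hypothesis is used from here on. -/
lemma val_nab_e {nab : Connection M} (hnab : MetricCompatible g nab) (b c : Fin 4) (x : M)
    (X : TangentSpace I4 x) :
    g.val x (Ξ.e b x) (nab (Ξ.e c) x X) = -g.val x (Ξ.e c x) (nab (Ξ.e b) x X) := by
  have h := hnab (Ξ.e b) (Ξ.e c) x ((Ξ.contMDiff_e b x).mdifferentiableAt (by simp))
    ((Ξ.contMDiff_e c x).mdifferentiableAt (by simp)) X
  simp only [val_e_e, mvfderiv_const, zero_apply] at h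
  rw [g.symm x _ (Ξ.e c x)] at h
  linarith

end SpinFrame

end

/-! ### Smooth fields and the connection biform in the gauge `Ξ` -/

section

variable {M : Type u} [TopologicalSpace M] [ChartedSpace E4 M] [IsManifold I4 ∞ M]
variable {g : LorentzMetric M} {S : SpinStructure.{u, v, w} g} (Ξ : SpinFrame S)

namespace SpinFrame

/-- Clifford fields with smooth components in the gauge `Ξ`. -/
def SmoothField (A : g.ClField) : Prop :=
  SmoothOnCl (fun x => (gauge (Ξ.cof x)).symm (A x)) Set.univ

variable {Ξ}

/-- A change of gauge conjugates the components by a smooth transition function. All derivatives can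
then be taken in one global gauge. -/
lemma smoothField_of_smoothClField {A : g.ClField} (hA : S.SmoothClField A) :
    Ξ.SmoothField A := by
  intro J
  rw [contMDiffOn_univ]
  intro x
  obtain ⟨i, hi⟩ := S.cover x
  obtain ⟨h, hh, hΞ⟩ := Ξ.smooth i
  refine ContMDiffOn.contMDiffAt ?_ ((S.isOpen_dom i).mem_nhds hi)
  refine SmoothOnCl.congr ((hh.spin_inv.mul (hA i)).mul hh) (fun y hy => ?_) J
  rw [cof, hΞ y hy, S.gauge_symm_rmul]

lemma SmoothField.add {A B : g.ClField} (hA : Ξ.SmoothField A) (hB : Ξ.SmoothField B) :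
    Ξ.SmoothField (A + B) :=
  (SmoothOnCl.add hA hB).congr fun _ _ => map_add _ _ _

lemma SmoothField.mul {A B : g.ClField} (hA : Ξ.SmoothField A) (hB : Ξ.SmoothField B) :
    Ξ.SmoothField (A * B) :=
  (SmoothOnCl.mul hA hB).congr fun _ _ => map_mul _ _ _

lemma SmoothField.smul {φ : M → ℝ} {A : g.ClField} (hφ : ContMDiff I4 𝓘(ℝ, ℝ) ∞ φ)
    (hA : Ξ.SmoothField A) : Ξ.SmoothField (fun x => φ x • A x) :=
  (SmoothOnCl.smul hφ.contMDiffOn hA).congr fun _ _ => map_smul _ _ _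

lemma SmoothField.const_smul (r : ℝ) {A : g.ClField} (hA : Ξ.SmoothField A) :
    Ξ.SmoothField (r • A) := hA.smul contMDiff_const

lemma SmoothField.sum {ι : Type*} {s : Finset ι} {A : ι → g.ClField}
    (hA : ∀ i ∈ s, Ξ.SmoothField (A i)) : Ξ.SmoothField (∑ i ∈ s, A i) :=
  (SmoothOnCl.sum hA).congr fun x _ => by rw [Finset.sum_apply, map_sum]

lemma SmoothField.sub {A B : g.ClField} (hA : Ξ.SmoothField A) (hB : Ξ.SmoothField B) :
    Ξ.SmoothField (A - B) := by
  have h : A - B = A + (-1 : ℝ) • B := by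
    funext x
    rw [Pi.sub_apply, Pi.add_apply, Pi.smul_apply, neg_one_smul, sub_eq_add_neg]
  rw [h]
  exact hA.add (hB.const_smul _)

variable (Ξ)

lemma smoothField_theta (a : Fin 4) : Ξ.SmoothField (Ξ.theta a) :=
  (smoothOnCl_const (CliffordAlgebra.ι minkowskiForm (Pi.single a 1)) _).congr fun _ _ =>
    gauge_symm_th _ _

lemma smoothField_pfaff {A : g.ClField} (hA : Ξ.SmoothField A) (a : Fin 4) :
    Ξ.SmoothField (fun x => Ξ.pfaff A x (Ξ.e a x)) := by
  refine (smoothOnCl_sum (s := Finset.univ) (fun J _ =>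
    (contMDiff_mvfderiv_apply (contMDiffOn_univ.1 (hA J)) (Ξ.contMDiff_e a)).contMDiffOn)
    (fun J => clBasis J)).congr fun x _ => ?_
  simp only [pfaff, AlgEquiv.symm_apply_apply, clDeriv]

lemma pfaff_add {A B : g.ClField} (hA : Ξ.SmoothField A) (hB : Ξ.SmoothField B) (x : M)
    (X : TangentSpace I4 x) : Ξ.pfaff (A + B) x X = Ξ.pfaff A x X + Ξ.pfaff B x X := by
  simp only [pfaff, Pi.add_apply, map_add, clDeriv_add hA hB]

lemma pfaff_mul {A B : g.ClField} (hA : Ξ.SmoothField A) (hB : Ξ.SmoothField B) (x : M)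
    (X : TangentSpace I4 x) :
    Ξ.pfaff (A * B) x X = Ξ.pfaff A x X * B x + A x * Ξ.pfaff B x X := by
  simp only [pfaff, Pi.mul_apply, map_mul, clDeriv_mul hA hB, map_add, AlgEquiv.apply_symm_apply]

lemma pfaff_theta (a : Fin 4) (x : M) (X : TangentSpace I4 x) : Ξ.pfaff (Ξ.theta a) x X = 0 := by
  simp only [pfaff, theta, gauge_symm_th, clDeriv_const, map_zero]

variable {nab : Connection M}

/-- In the coframe the pairing is a double sum whose terms are antisymmetric by `val_nab_e`.
Skewness is what gives `extDer` its meaning here. -/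
lemma isSkew_covecConn (hnab : MetricCompatible g nab) (x : M) (X : TangentSpace I4 x) :
    IsSkew (g.coform x) (Ξ.covecConn nab x X) := by
  intro α
  obtain ⟨p, rfl⟩ : ∃ p, Ξ.cof x p = α := (Ξ.cof x).toLinearEquiv.surjective α
  have h1 (c d : Fin 4) : covec (Ξ.cof x) c (nab (Ξ.e d) x X) =
      eta c c * g.val x (Ξ.e c x) (nab (Ξ.e d) x X) := covec_apply _ _ _
  have h2 (α : Cotangent x) : Ξ.covecConn nab x X α =
      -∑ c, α (nab (Ξ.e c) x X) • covec (Ξ.cof x) c := rfl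
  rw [QuadraticMap.polar_comm, coform_polar, h2, coframe_apply]
  simp only [map_sum, map_smul, sharp_covec, LinearMap.neg_apply, LinearMap.sum_apply,
    LinearMap.smul_apply, smul_eq_mul, h1, covec_vec, mul_ite, mul_one, mul_zero,
    Finset.sum_ite_eq', Finset.mem_univ, if_true]
  have hs : ∑ c, (∑ d, p d * (eta d d * g.val x (Ξ.e d x) (nab (Ξ.e c) x X))) *
      (p c * eta c c) = 0 := by
    set f : Fin 4 → Fin 4 → ℝ := fun c d =>
      (p d * (eta d d * g.val x (Ξ.e d x) (nab (Ξ.e c) x X))) * (p c * eta c c) with hf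
    have hskew : ∀ c d, f c d = -f d c := fun c d => by
      simp only [hf]
      rw [Ξ.val_nab_e hnab d c]
      ring
    have h : ∑ c, ∑ d, f c d = -∑ c, ∑ d, f c d := by
      conv_lhs => rw [Finset.sum_comm]
      simp only [← Finset.sum_neg_distrib]
      exact Finset.sum_congr rfl fun c _ => Finset.sum_congr rfl fun d _ => hskew d c
    simp only [Finset.sum_mul]
    linarith
  refine mul_eq_zero_of_right _ (neg_eq_zero.1 ?_)
  rw [← Finset.sum_neg_distrib, ← hs]
  exact Finset.sum_congr rfl fun c _ => by ring

/-- Wedge and Clifford products differ by the scalars `η_{ab}`, which vanish against skew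
coefficients (`hz`). The signs that raise the indices of `ω^{ab}` cancel those that lower the
indices of `θ_a`, `θ_b`. -/
lemma omega_eq (hnab : MetricCompatible g nab) (X : (x : M) → TangentSpace I4 x) (x : M) :
    Ξ.omega nab X x = (1 / 2 : ℝ) • ∑ a, ∑ b,
      g.val x (Ξ.e a x) (nab (Ξ.e b) x (X x)) • (Ξ.theta a x * Ξ.theta b x) := by
  have hz : ∑ a, ∑ b, g.val x (Ξ.e a x) (nab (Ξ.e b) x (X x)) •
      algebraMap ℝ (g.Cl x) (eta a b) = 0 := by
    refine Finset.sum_eq_zero fun a _ => Finset.sum_eq_zero fun b _ => ?_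
    by_cases h : a = b
    · subst h
      have := Ξ.val_nab_e hnab a a x (X x)
      rw [show g.val x (Ξ.e a x) (nab (Ξ.e a) x (X x)) = 0 by linarith, zero_smul]
    · rw [eta_ne h, map_zero, smul_zero]
  rw [omega, ← sub_zero (∑ a, ∑ b, g.val x (Ξ.e a x) (nab (Ξ.e b) x (X x)) •
    (Ξ.theta a x * Ξ.theta b x)), ← hz, ← Finset.sum_sub_distrib]
  congr 1
  refine Finset.sum_congr rfl fun a _ => ?_
  rw [← Finset.sum_sub_distrib]
  refine Finset.sum_congr rfl fun b _ => ?_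
  rw [← smul_sub, theta, theta, ← wedge_th, sum_eta_mul, thLow_eq, thLow_eq, covec_apply]
  simp only [wedge, map_smul, smul_mul_smul_comm, smul_smul]
  congr 1
  have ha := eta_sq a
  have hb := eta_sq b
  change eta b b * (eta a a * g.val x (Ξ.e a x) _) * _ = _
  linear_combination (eta a a * eta a a * g.val x (Ξ.e a x) (nab (Ξ.e b) x (X x))) * hb +
    g.val x (Ξ.e a x) (nab (Ξ.e b) x (X x)) * ha

lemma smoothField_omega (hnab : MetricCompatible g nab)
    [CovariantDerivative.ContMDiffCovariantDerivative nab ∞] (a : Fin 4) :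
    Ξ.SmoothField (Ξ.omega nab (Ξ.e a)) := by
  have h : Ξ.omega nab (Ξ.e a) = (1 / 2 : ℝ) • ∑ c, ∑ b, fun x =>
      g.val x (Ξ.e c x) (nab (Ξ.e b) x (Ξ.e a x)) • (Ξ.theta c * Ξ.theta b) x := by
    ext x
    rw [omega_eq Ξ hnab]
    simp only [Pi.smul_apply, Finset.sum_apply, Pi.mul_apply]
  rw [h]
  exact SmoothField.const_smul _ <| SmoothField.sum fun c _ => SmoothField.sum fun b _ =>
    SmoothField.smul (g.contMDiff_apply (Ξ.contMDiff_e c)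
      (contMDiff_connection nab (Ξ.contMDiff_e b) (Ξ.contMDiff_e a)))
      ((Ξ.smoothField_theta c).mul (Ξ.smoothField_theta b))

end SpinFrame

end

/-! ### The connection as a commutator, and the square of the Dirac operator -/

section

variable {M : Type u} [TopologicalSpace M] [ChartedSpace E4 M] [IsManifold I4 ∞ M]
variable {g : LorentzMetric M} {S : SpinStructure.{u, v, w} g} (Ξ : SpinFrame S)

lemma th_mul_th_commutator {x : M} (F : g.Coframe x) (a b d : Fin 4) :
    th F a * th F b * th F d - th F d * (th F a * th F b) =
      (2 * eta b d) • th F a - (2 * eta a d) • th F b := by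
  have h1 := th_mul_th_add F b d
  have h2 := th_mul_th_add F a d
  rw [Algebra.smul_def, Algebra.smul_def, ← h2, Algebra.commutes, ← h1]
  noncomm_ring

namespace SpinFrame

variable {nab : Connection M}

lemma covecConn_covec (x : M) (X : TangentSpace I4 x) (d : Fin 4) :
    Ξ.covecConn nab x X (covec (Ξ.cof x) d) =
      -∑ c, covec (Ξ.cof x) d (nab (Ξ.e c) x X) • covec (Ξ.cof x) c := rfl

/-- The derivation of the Clifford algebra induced by the connection is `½[ω_X, ·]`. -/
lemma omega_commutator_ι (hnab : MetricCompatible g nab) (X : (x : M) → TangentSpace I4 x) (x : M)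
    (α : Cotangent x) :
    (1 / 2 : ℝ) • (Ξ.omega nab X x * CliffordAlgebra.ι (g.coform x) α -
        CliffordAlgebra.ι (g.coform x) α * Ξ.omega nab X x) =
      CliffordAlgebra.ι (g.coform x) (Ξ.covecConn nab x (X x) α) := by
  have key (d : Fin 4) : (1 / 2 : ℝ) • (Ξ.omega nab X x * th (Ξ.cof x) d -
        th (Ξ.cof x) d * Ξ.omega nab X x) =
      CliffordAlgebra.ι (g.coform x) (Ξ.covecConn nab x (X x) (covec (Ξ.cof x) d)) := by
    set N : Fin 4 → Fin 4 → ℝ := fun a b => g.val x (Ξ.e a x) (nab (Ξ.e b) x (X x)) with hN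
    have hskew (a b : Fin 4) : N a b = -N b a := Ξ.val_nab_e hnab a b x (X x)
    have hcov (a b : Fin 4) : covec (Ξ.cof x) a (nab (Ξ.e b) x (X x)) = eta a a * N a b :=
      covec_apply _ _ _
    have hcomm : Ξ.omega nab X x * th (Ξ.cof x) d - th (Ξ.cof x) d * Ξ.omega nab X x =
        (1 / 2 : ℝ) • ∑ a, ∑ b, N a b •
          ((2 * eta b d) • th (Ξ.cof x) a - (2 * eta a d) • th (Ξ.cof x) b) := by
      rw [omega_eq Ξ hnab, smul_mul_assoc, mul_smul_comm, ← smul_sub]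
      simp only [Finset.sum_mul, Finset.mul_sum, smul_mul_assoc, mul_smul_comm,
        ← Finset.sum_sub_distrib, ← smul_sub, theta, th_mul_th_commutator, hN]
    -- By skewness the two contractions add up to `-4 η_{dd} N_{da} θ^a`; the halves in `ω` and in
    -- front of the commutator reduce this to `∇_X θ^d`.
    have h1 : ∑ a, ∑ b, (N a b * (2 * eta b d)) • th (Ξ.cof x) a =
        -∑ a, (2 * eta d d * N d a) • th (Ξ.cof x) a := by
      rw [← Finset.sum_neg_distrib]
      refine Finset.sum_congr rfl fun a _ => ?_
      rw [Finset.sum_eq_single d (fun b _ hb => by rw [eta_ne hb, mul_zero, mul_zero, zero_smul])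
        (by simp), ← neg_smul, hskew a d]
      congr 1
      ring
    have h2 : ∑ a, ∑ b, (N a b * (2 * eta a d)) • th (Ξ.cof x) b =
        ∑ b, (2 * eta d d * N d b) • th (Ξ.cof x) b := by
      rw [Finset.sum_eq_single d (fun a _ ha => Finset.sum_eq_zero fun b _ => by
        rw [eta_ne ha, mul_zero, mul_zero, zero_smul]) (by simp)]
      exact Finset.sum_congr rfl fun b _ => by congr 1; ring
    rw [hcomm]
    simp only [smul_sub, smul_smul, Finset.sum_sub_distrib, h1, h2, covecConn_covec, hcov, map_neg,
      map_sum, map_smul, ← th.eq_def, Finset.smul_sum, ← Finset.sum_neg_distrib, smul_neg]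
    rw [← Finset.sum_sub_distrib]
    refine Finset.sum_congr rfl fun a _ => ?_
    module
  obtain ⟨p, rfl⟩ : ∃ p, Ξ.cof x p = α := (Ξ.cof x).toLinearEquiv.surjective α
  rw [coframe_apply]
  simp only [map_sum, map_smul, ← key, ← th.eq_def, Finset.mul_sum, Finset.sum_mul,
    mul_smul_comm, smul_mul_assoc, ← Finset.sum_sub_distrib, Finset.smul_sum, smul_sub]
  exact Finset.sum_congr rfl fun a _ => by module

lemma nabCl_eq (hnab : MetricCompatible g nab) (X : (x : M) → TangentSpace I4 x) (A : g.ClField)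
    (x : M) : Ξ.nabCl nab X A x = Ξ.pfaff A x (X x) +
      (1 / 2 : ℝ) • (Ξ.omega nab X x * A x - A x * Ξ.omega nab X x) := by
  rw [nabCl, extDer_eq_commutator (Ξ.isSkew_covecConn hnab x (X x))
    (Ξ.omega_commutator_ι hnab X x)]

lemma nabCl_add {A B : g.ClField} (hA : Ξ.SmoothField A)
    (hB : Ξ.SmoothField B) (X : (x : M) → TangentSpace I4 x) :
    Ξ.nabCl nab X (A + B) = Ξ.nabCl nab X A + Ξ.nabCl nab X B := by
  funext x
  simp only [nabCl, Ξ.pfaff_add hA hB, Pi.add_apply, extDer_add]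
  abel

lemma nabCl_mul (hnab : MetricCompatible g nab) {A B : g.ClField} (hA : Ξ.SmoothField A)
    (hB : Ξ.SmoothField B) (X : (x : M) → TangentSpace I4 x) :
    Ξ.nabCl nab X (A * B) = Ξ.nabCl nab X A * B + A * Ξ.nabCl nab X B := by
  funext x
  simp only [nabCl, Ξ.pfaff_mul hA hB, Pi.add_apply, Pi.mul_apply,
    extDer_mul (Ξ.isSkew_covecConn hnab x (X x))]
  noncomm_ring

/-- A real scalar is treated as a constant Clifford field, so the Leibniz rule applies. -/
lemma nabCl_const_smul (hnab : MetricCompatible g nab) (r : ℝ) {A : g.ClField}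
    (hA : Ξ.SmoothField A) (X : (x : M) → TangentSpace I4 x) :
    Ξ.nabCl nab X (r • A) = r • Ξ.nabCl nab X A := by
  have hr (y : M) : algebraMap ℝ (g.Cl y) r = gauge (Ξ.cof y) (algebraMap ℝ _ r) :=
    (AlgEquiv.commutes _ _).symm
  have hs : Ξ.SmoothField fun y => algebraMap ℝ (g.Cl y) r :=
    (smoothOnCl_const (algebraMap ℝ Cl13 r) _).congr fun y _ => by
      rw [AlgEquiv.symm_apply_eq]; exact hr y
  have h0 : r • A = (fun y => algebraMap ℝ (g.Cl y) r) * A := by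
    funext y
    rw [Pi.mul_apply, ← Algebra.smul_def, Pi.smul_apply]
  rw [h0, Ξ.nabCl_mul hnab hs hA]
  have h1 : Ξ.nabCl nab X (fun y => algebraMap ℝ (g.Cl y) r) = 0 := by
    funext x
    rw [nabCl, extDer_algebraMap, add_zero]
    simp only [pfaff, hr, AlgEquiv.symm_apply_apply, clDeriv_const, map_zero]
    rfl
  funext x
  rw [h1, Pi.add_apply, Pi.mul_apply, Pi.mul_apply, Pi.zero_apply, zero_mul, zero_add,
    Pi.smul_apply, Algebra.smul_def]

lemma nabCl_sum {ι : Type*} (s : Finset ι) {A : ι → g.ClField}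
    (hA : ∀ i ∈ s, Ξ.SmoothField (A i)) (X : (x : M) → TangentSpace I4 x) :
    Ξ.nabCl nab X (∑ i ∈ s, A i) = ∑ i ∈ s, Ξ.nabCl nab X (A i) := by
  induction s using Finset.cons_induction with
  | empty =>
    funext x
    have h := extDer_algebraMap (Q := g.coform x) (T := Ξ.covecConn nab x (X x)) 0
    rw [map_zero] at h
    simp only [Finset.sum_empty, nabCl, pfaff, Pi.zero_apply, map_zero, h, clDeriv_const, add_zero]
  | cons i s hi ih =>
    rw [Finset.sum_cons, Finset.sum_cons, Ξ.nabCl_add (hA i (by simp))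
      (SmoothField.sum fun j hj => hA j (by simp [hj])), ih fun j hj => hA j (by simp [hj])]

lemma nabCl_theta (hnab : MetricCompatible g nab) (a b : Fin 4) (x : M) :
    Ξ.nabCl nab (Ξ.e a) (Ξ.theta b) x = -∑ c, Ξ.Gam nab a c b x • Ξ.theta c x := by
  rw [nabCl, pfaff_theta, zero_add, theta, th, extDer_ι (Ξ.isSkew_covecConn hnab x _),
    covecConn_covec, map_neg, map_sum]
  simp only [map_smul]
  rfl

/-- The commutator formula exhibits the pointwise defined derivation through products of smooth
fields. -/
lemma smoothField_nabCl (hnab : MetricCompatible g nab)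
    [CovariantDerivative.ContMDiffCovariantDerivative nab ∞] {A : g.ClField}
    (hA : Ξ.SmoothField A) (a : Fin 4) : Ξ.SmoothField (Ξ.nabCl nab (Ξ.e a) A) := by
  have h : Ξ.nabCl nab (Ξ.e a) A = (fun x => Ξ.pfaff A x (Ξ.e a x)) +
      (1 / 2 : ℝ) • (Ξ.omega nab (Ξ.e a) * A - A * Ξ.omega nab (Ξ.e a)) :=
    funext fun x => Ξ.nabCl_eq hnab _ A x
  have ho := Ξ.smoothField_omega hnab a
  rw [h]
  exact (Ξ.smoothField_pfaff hA a).add (((ho.mul hA).sub (hA.mul ho)).const_smul _)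

/-- The Dirac operator on `θ^b B_b`. -/
lemma sum_theta_mul_nabCl_sum (hnab : MetricCompatible g nab) {B : Fin 4 → g.ClField}
    (hB : ∀ b, Ξ.SmoothField (B b)) (x : M) :
    ∑ a, Ξ.theta a x * Ξ.nabCl nab (Ξ.e a) (∑ b, Ξ.theta b * B b) x =
      ∑ a, ∑ b, Ξ.theta a x * Ξ.theta b x *
        (Ξ.nabCl nab (Ξ.e a) (B b) x - ∑ c, Ξ.Gam nab a b c x • B c x) := by
  refine Finset.sum_congr rfl fun a _ => ?_
  rw [Ξ.nabCl_sum _ fun b _ => (Ξ.smoothField_theta b).mul (hB b), Finset.sum_apply]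
  simp only [Ξ.nabCl_mul hnab (Ξ.smoothField_theta _) (hB _), Pi.add_apply, Pi.mul_apply,
    Ξ.nabCl_theta hnab, mul_assoc, ← Finset.mul_sum]
  congr 1
  simp only [mul_sub, Finset.sum_sub_distrib, Finset.sum_add_distrib, neg_mul,
    Finset.sum_neg_distrib, Finset.sum_mul, Finset.mul_sum, smul_mul_assoc, mul_smul_comm]
  -- Exchanging `b` and `c` matches the terms from `∇θ^b` with `-Γ_{ab}^c θ^b B_c`.
  rw [Finset.sum_comm]
  abel

lemma dirac_dirac (hnab : MetricCompatible g nab)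
    [CovariantDerivative.ContMDiffCovariantDerivative nab ∞] {A : g.ClField}
    (hA : Ξ.SmoothField A) (x : M) :
    Ξ.dirac nab (Ξ.dirac nab A) x = ∑ a, ∑ b, Ξ.theta a x * Ξ.theta b x *
      (Ξ.nabCl nab (Ξ.e a) (Ξ.nabCl nab (Ξ.e b) A) x -
        ∑ c, Ξ.Gam nab a b c x • Ξ.nabCl nab (Ξ.e c) A x) := by
  rw [← Ξ.sum_theta_mul_nabCl_sum hnab fun b => Ξ.smoothField_nabCl hnab hA b]
  simp only [dirac, Finset.sum_apply, Pi.mul_apply]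

/-- Recombines the two sums, so that the formulas for the squares can be checked on the coefficients
of `θ^aθ^b` for each `a`, `b`. -/
lemma eta_add_thetaWedge (T : Fin 4 → Fin 4 → g.ClField) (x : M) :
    (∑ a, ∑ b, eta a b • T a b) x + (∑ a, ∑ b, Ξ.thetaWedge a b * T a b) x =
      ∑ a, ∑ b, Ξ.theta a x * Ξ.theta b x * T a b x := by
  simp only [Finset.sum_apply, ← Finset.sum_add_distrib, Pi.smul_apply, Pi.mul_apply, thetaWedge,
    theta, wedge_th, sub_mul, Algebra.smul_def]
  exact Finset.sum_congr rfl fun a _ => Finset.sum_congr rfl fun b _ => by abel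

end SpinFrame

end

/-! ### Spinor fields in the gauge `Ξ` and the square of the spin-Dirac operator -/

section

variable {M : Type u} [TopologicalSpace M] [ChartedSpace E4 M] [IsManifold I4 ∞ M]
variable {g : LorentzMetric M} {S : SpinStructure.{u, v, w} g} (Ξ : SpinFrame S)

lemma SpinStructure.smul_apply {x : M} (A : g.Cl x) (f : S.Spinor x) (p : S.P x) :
    (A • f).1 p = (gauge (S.coframe p)).symm A * f.1 p := rfl

namespace SpinFrame

lemma onUnit_apply (A : g.ClField) (x : M) :
    (Ξ.onUnit A x).1 (Ξ.val x) = (gauge (Ξ.cof x)).symm (A x) := by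
  rw [onUnit, S.smul_apply, unitSection, S.cls_apply_self, mul_one]
  rfl

lemma onUnit_injective : Function.Injective Ξ.onUnit := fun A B h => funext fun x =>
  (gauge (Ξ.cof x)).symm.injective (by rw [← onUnit_apply, ← onUnit_apply, h])

lemma spinorField_ext {ψ ψ' : S.SpinorField} (h : ∀ x, (ψ x).1 (Ξ.val x) = (ψ' x).1 (Ξ.val x)) :
    ψ = ψ' := funext fun x => S.spinor_ext (Ξ.val x) (h x)

/-- Every smooth left spin-Clifford field is `A 1^ℓ_Ξ` for exactly one smooth Clifford field. -/
lemma existsUnique_onUnit {ψ : S.SpinorField} (hψ : S.SmoothSpinorField ψ) :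
    ∃! A : g.ClField, S.SmoothClField A ∧ ψ = Ξ.onUnit A := by
  have hA : ψ = Ξ.onUnit fun x => gauge (Ξ.cof x) ((ψ x).1 (Ξ.val x)) :=
    Ξ.spinorField_ext fun x => by rw [onUnit_apply, AlgEquiv.symm_apply_apply]
  refine ⟨_, ⟨fun i => ?_, hA⟩, fun B hB => Ξ.onUnit_injective (hB.2 ▸ hA)⟩
  obtain ⟨h, hh, hΞ⟩ := Ξ.smooth i
  -- If `f` is the component of `ψ` in the local gauge, then in the gauge `Ξ` it is `h⁻¹f`, and
  -- conjugating back by `h` gives `h(h⁻¹f)h⁻¹ = fh⁻¹` for `A`.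
  refine ((hψ i).mul hh.spin_inv).congr fun y hy => ?_
  have hs : (h y : Cl13) * (((h y)⁻¹ : Spin13) : Cl13) = 1 := by
    rw [← Submonoid.coe_mul, mul_inv_cancel, Submonoid.coe_one]
  rw [AlgEquiv.symm_apply_eq, cof, hΞ y hy, S.gauge_rmul, (ψ y).2]
  congr 1
  simp only [← mul_assoc]
  rw [hs, one_mul]

/-- Left multiplication by `½ω_X` is the commutator part, which completes the Pfaff derivative to
`∇_X A`, plus right multiplication by `½ω_X`. -/
lemma nabSpin_onUnit {nab : Connection M} (hnab : MetricCompatible g nab)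
    (X : (x : M) → TangentSpace I4 x) (A : g.ClField) :
    Ξ.nabSpin nab X (Ξ.onUnit A) =
      Ξ.onUnit (Ξ.nabCl nab X A + (1 / 2 : ℝ) • (A * Ξ.omega nab X)) := by
  refine Ξ.spinorField_ext fun x => ?_
  rw [onUnit_apply, Pi.add_apply, Ξ.nabCl_eq hnab]
  change (Ξ.pfaffSpin (Ξ.onUnit A) x (X x)).1 (Ξ.val x) +
    (1 / 2 : ℝ) • (Ξ.omega nab X x • Ξ.onUnit A x).1 (Ξ.val x) = _
  rw [S.smul_apply, pfaffSpin, S.cls_apply_self, Ξ.onUnit_apply A x, Pi.smul_apply, Pi.mul_apply]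
  simp only [Ξ.onUnit_apply A, pfaff, map_add, map_smul, map_sub, map_mul,
    AlgEquiv.symm_apply_apply]
  change clDeriv _ x (X x) + (1 / 2 : ℝ) • ((gauge (Ξ.cof x)).symm _ * _) = _
  module

lemma onUnit_sum_theta (B : Fin 4 → g.ClField) (x : M) :
    ∑ a, Ξ.theta a x • Ξ.onUnit (B a) x = Ξ.onUnit (∑ a, Ξ.theta a * B a) x := by
  simp only [onUnit, Finset.sum_apply, Pi.mul_apply, Finset.sum_smul, mul_smul]

lemma spinDirac_onUnit {nab : Connection M} (hnab : MetricCompatible g nab) (A : g.ClField) :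
    Ξ.spinDirac nab (Ξ.onUnit A) = Ξ.onUnit (∑ a, Ξ.theta a *
      (Ξ.nabCl nab (Ξ.e a) A + (1 / 2 : ℝ) • (A * Ξ.omega nab (Ξ.e a)))) := by
  funext x
  simp only [spinDirac, Ξ.nabSpin_onUnit hnab, onUnit_sum_theta]

/-- The square of the spin-Dirac operator in terms of the square of the Dirac operator. -/
lemma spinDirac_spinDirac {nab : Connection M} (hnab : MetricCompatible g nab)
    [CovariantDerivative.ContMDiffCovariantDerivative nab ∞] {A : g.ClField}
    (hA : Ξ.SmoothField A) :
    Ξ.spinDirac nab (Ξ.spinDirac nab (Ξ.onUnit A)) =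
      Ξ.onUnit (Ξ.dirac nab (Ξ.dirac nab A)
        + ∑ a, ∑ b, eta a b • Ξ.S2 nab a b A
        + ∑ a, ∑ b, Ξ.thetaWedge a b * Ξ.S2 nab a b A) := by
  rw [Ξ.spinDirac_onUnit hnab, Ξ.spinDirac_onUnit hnab]
  congr 1
  funext x
  have hn (b : Fin 4) := Ξ.smoothField_nabCl hnab hA b
  have ho (b : Fin 4) := Ξ.smoothField_omega hnab b
  have hAo (b : Fin 4) := hA.mul (ho b)
  rw [Pi.add_apply, Pi.add_apply, add_assoc, eta_add_thetaWedge, Ξ.dirac_dirac hnab hA]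
  simp only [Finset.sum_apply, Pi.mul_apply, Pi.add_apply, mul_add, Finset.sum_add_distrib]
  -- Here `B_b = ∇_b A + ½Aω_b`, the field produced by the first spin-Dirac operator.
  rw [Ξ.sum_theta_mul_nabCl_sum hnab fun b => (hn b).add ((hAo b).const_smul _)]
  simp only [← Finset.sum_add_distrib, Finset.sum_apply, Pi.smul_apply, Pi.mul_apply,
    Finset.sum_mul, Finset.smul_sum, Finset.mul_sum]
  refine Finset.sum_congr rfl fun a _ => Finset.sum_congr rfl fun b _ => ?_
  rw [Ξ.nabCl_add (hn b) ((hAo b).const_smul _), Ξ.nabCl_const_smul hnab _ (hAo b),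
    Ξ.nabCl_mul hnab hA (ho b), mul_assoc (Ξ.theta b x), ← mul_smul_comm, ← mul_assoc, ← mul_add,
    ← mul_add]
  congr 1
  simp only [S2, Pi.add_apply, Pi.smul_apply, Pi.mul_apply, smul_add, Finset.sum_add_distrib,
    add_mul, smul_mul_assoc, mul_assoc, Finset.smul_sum, smul_smul, mul_comm (1 / 2 : ℝ)]
  module

end SpinFrame

end

/-! ### Vanishing strain: torsion and the Levi-Civita connection -/

section

variable {M : Type u} [TopologicalSpace M] [ChartedSpace E4 M] [IsManifold I4 ∞ M]
variable {g : LorentzMetric M} {S : SpinStructure.{u, v, w} g} (Ξ : SpinFrame S)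

lemma IsSkew.smul_sub {V : Type*} [AddCommGroup V] [Module ℝ V] {Q : QuadraticForm ℝ V}
    {T T' : V →ₗ[ℝ] V} (h : IsSkew Q T) (h' : IsSkew Q T') (r : ℝ) : IsSkew Q (r • (T - T')) :=
  fun v => by
    rw [LinearMap.smul_apply, LinearMap.sub_apply, QuadraticMap.polar_smul_right,
      QuadraticMap.polar_sub_right, h v, h' v, sub_zero, smul_zero]

namespace SpinFrame

variable {nab D : Connection M}

/-- If the strain tensor vanishes, then the torsion operator is twice the difference of the
connection and the Levi-Civita connection. -/
lemma torCovec_eq (hnab : MetricCompatible g nab) (hD : MetricCompatible g D)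
    (hs : ∀ a b c x, Ξ.Strain nab D a b c x = 0) (a : Fin 4) (x : M) :
    torCovec g nab x (Ξ.e a x) =
      (2 : ℝ) • (Ξ.covecConn nab x (Ξ.e a x) - Ξ.covecConn D x (Ξ.e a x)) := by
  have hT (b d : Fin 4) : g.val x (Ξ.e d x) (nab.torsion x (Ξ.e a x) (Ξ.e b x)) =
      2 * (g.val x (Ξ.e d x) (nab (Ξ.e b) x (Ξ.e a x)) -
        g.val x (Ξ.e d x) (D (Ξ.e b) x (Ξ.e a x))) := by
    have h := hs a b d x
    have hTor : Ξ.Tor nab a b d x =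
      eta d d * g.val x (Ξ.e d x) (nab.torsion x (Ξ.e a x) (Ξ.e b x)) := covec_apply _ _ _
    rw [Strain, Gam_eq, Gam_eq, hTor] at h
    have hd : eta d d ≠ 0 := fun h0 => by
      have := eta_sq d
      rw [h0] at this
      norm_num at this
    refine mul_left_cancel₀ hd ?_
    linarith
  have key (b : Fin 4) : torCovec g nab x (Ξ.e a x) (covec (Ξ.cof x) b) =
      (2 : ℝ) • (Ξ.covecConn nab x (Ξ.e a x) (covec (Ξ.cof x) b) -
        Ξ.covecConn D x (Ξ.e a x) (covec (Ξ.cof x) b)) := by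
    rw [← sum_apply_vec_smul_covec (Ξ.cof x) (torCovec g nab x (Ξ.e a x) (covec (Ξ.cof x) b))]
    have h1 (d : Fin 4) : torCovec g nab x (Ξ.e a x) (covec (Ξ.cof x) b) (Ξ.e d x) =
        eta b b * g.val x (Ξ.e d x) (nab.torsion x (Ξ.e a x) (Ξ.e b x)) := by
      change g.flat x (nab.torsion x (Ξ.e a x) (g.sharp x (covec (Ξ.cof x) b))) (Ξ.e d x) = _
      rw [sharp_covec, flat_apply, map_smul, g.symm, map_smul, smul_eq_mul]
      rfl
    have h2 (nab : Connection M) (d : Fin 4) :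
        covec (Ξ.cof x) b (nab (Ξ.e d) x (Ξ.e a x)) =
          eta b b * g.val x (Ξ.e b x) (nab (Ξ.e d) x (Ξ.e a x)) := covec_apply _ _ _
    simp only [covecConn_covec, ← e.eq_def, h1, hT, h2, ← Finset.sum_neg_distrib]
    rw [← Finset.sum_sub_distrib, Finset.smul_sum]
    refine Finset.sum_congr rfl fun d _ => ?_
    -- The torsion pairs `e_d` with derivatives of `e_b`, the action on covectors pairs `e_b` with
    -- derivatives of `e_d`; skewness of both connections supplies the sign.
    rw [Ξ.val_nab_e hnab d b, Ξ.val_nab_e hD d b]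
    module
  ext1 α
  obtain ⟨p, rfl⟩ : ∃ p, Ξ.cof x p = α := (Ξ.cof x).toLinearEquiv.surjective α
  rw [coframe_apply, map_sum, map_sum]
  exact Finset.sum_congr rfl fun b _ => by
    rw [map_smul, map_smul, key, LinearMap.smul_apply, LinearMap.sub_apply]

/-- If the strain tensor vanishes, then `∇_a A = D_a A + ½ τ(e_a, A)`. -/
lemma nabCl_eq_add_tau (hnab : MetricCompatible g nab) (hD : MetricCompatible g D)
    (hs : ∀ a b c x, Ξ.Strain nab D a b c x = 0) (a : Fin 4) (A : g.ClField) :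
    Ξ.nabCl nab (Ξ.e a) A =
      Ξ.nabCl D (Ξ.e a) A + (1 / 2 : ℝ) • tau g nab (Ξ.e a) A := by
  funext x
  -- The torsion operator inherits skew-adjointness from the two connections, so `tau` is a true
  -- extension and not the default value `0` of `extDer`.
  have hskew := (Ξ.isSkew_covecConn hnab x (Ξ.e a x)).smul_sub (Ξ.isSkew_covecConn hD x (Ξ.e a x)) 2
  have h : tau g nab (Ξ.e a) A x = (1 / 2 : ℝ) •
      ((2 : ℝ) • (Ξ.omega nab (Ξ.e a) x - Ξ.omega D (Ξ.e a) x) * A x -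
        A x * (2 : ℝ) • (Ξ.omega nab (Ξ.e a) x - Ξ.omega D (Ξ.e a) x)) := by
    rw [tau, Ξ.torCovec_eq hnab hD hs]
    refine extDer_eq_commutator hskew (fun α => ?_) _
    rw [LinearMap.smul_apply, LinearMap.sub_apply, map_smul, map_sub,
      ← Ξ.omega_commutator_ι hnab, ← Ξ.omega_commutator_ι hD]
    simp only [sub_mul, mul_sub, smul_mul_assoc, mul_smul_comm]
    module
  rw [Pi.add_apply, Pi.smul_apply, Ξ.nabCl_eq hnab, Ξ.nabCl_eq hD, h]
  simp only [sub_mul, mul_sub, smul_mul_assoc, mul_smul_comm]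
  module

/-- Smoothness is inherited from `∇` and `D`, since `τ(e_a, A) = 2(∇_a A - D_a A)`. -/
lemma smoothField_tau [CovariantDerivative.ContMDiffCovariantDerivative nab ∞]
    [CovariantDerivative.ContMDiffCovariantDerivative D ∞]
    (hnab : MetricCompatible g nab) (hD : MetricCompatible g D)
    (hs : ∀ a b c x, Ξ.Strain nab D a b c x = 0) (a : Fin 4) {A : g.ClField}
    (hA : Ξ.SmoothField A) : Ξ.SmoothField (tau g nab (Ξ.e a) A) := by
  have h : tau g nab (Ξ.e a) A =
      (2 : ℝ) • (Ξ.nabCl nab (Ξ.e a) A - Ξ.nabCl D (Ξ.e a) A) := by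
    rw [Ξ.nabCl_eq_add_tau hnab hD hs]
    funext x
    rw [Pi.smul_apply, Pi.sub_apply, Pi.add_apply, Pi.smul_apply]
    module
  rw [h]
  exact ((Ξ.smoothField_nabCl hnab hA a).sub (Ξ.smoothField_nabCl hD hA a)).const_smul _

/-- The square of the Dirac operator in terms of the square of the standard Dirac operator. -/
lemma dirac_dirac_eq_standard [CovariantDerivative.ContMDiffCovariantDerivative nab ∞]
    [CovariantDerivative.ContMDiffCovariantDerivative D ∞]
    (hnab : MetricCompatible g nab) (hD : MetricCompatible g D)
    (hs : ∀ a b c x, Ξ.Strain nab D a b c x = 0) {A : g.ClField} (hA : Ξ.SmoothField A) :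
    Ξ.dirac nab (Ξ.dirac nab A) = Ξ.dirac D (Ξ.dirac D A)
      + ∑ a, ∑ b, eta a b • Ξ.S1 nab D a b A
      + ∑ a, ∑ b, Ξ.thetaWedge a b * Ξ.S1 nab D a b A := by
  funext x
  rw [Pi.add_apply, Pi.add_apply, add_assoc, eta_add_thetaWedge, Ξ.dirac_dirac hnab hA,
    Ξ.dirac_dirac hD hA, ← Finset.sum_add_distrib]
  refine Finset.sum_congr rfl fun a _ => ?_
  rw [← Finset.sum_add_distrib]
  refine Finset.sum_congr rfl fun b _ => ?_
  rw [← mul_add]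
  congr 1
  have hτ := Ξ.smoothField_tau hnab hD hs b hA
  have hΓ (c : Fin 4) : Ξ.Gam nab a b c x = Ξ.Gam D a b c x + (1 / 2) * Ξ.Tor nab a b c x := by
    have := hs a b c x
    rw [Strain] at this
    linarith
  have htau (B C : g.ClField) : tau g nab (Ξ.e a) (B + (1 / 2 : ℝ) • C) x =
      tau g nab (Ξ.e a) B x + (1 / 2 : ℝ) • tau g nab (Ξ.e a) C x := by
    simp only [tau, Pi.add_apply, Pi.smul_apply, extDer_add]
    congr 1
    unfold extDer
    split_ifs <;> simp
  rw [Ξ.nabCl_eq_add_tau hnab hD hs a, Pi.add_apply, Pi.smul_apply,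
    Ξ.nabCl_eq_add_tau hnab hD hs b, htau,
    Ξ.nabCl_add (Ξ.smoothField_nabCl hD hA b) (hτ.const_smul _), Ξ.nabCl_const_smul hD _ hτ]
  -- The product of `Γ̊ + ½T` with `D + ½τ`: the first of the four terms belongs to the standard
  -- square, the others to `S₁`.
  have hsum : ∑ c, Ξ.Gam nab a b c x • Ξ.nabCl nab (Ξ.e c) A x =
      ∑ c, Ξ.Gam D a b c x • Ξ.nabCl D (Ξ.e c) A x
        + (1 / 2 : ℝ) • ∑ c, Ξ.Gam D a b c x • tau g nab (Ξ.e c) A x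
        + (1 / 2 : ℝ) • ∑ c, Ξ.Tor nab a b c x • Ξ.nabCl D (Ξ.e c) A x
        + (1 / 4 : ℝ) • ∑ c, Ξ.Tor nab a b c x • tau g nab (Ξ.e c) A x := by
    simp only [Finset.smul_sum, ← Finset.sum_add_distrib]
    refine Finset.sum_congr rfl fun c _ => ?_
    rw [Ξ.nabCl_eq_add_tau hnab hD hs c, hΓ, Pi.add_apply, Pi.smul_apply]
    module
  rw [hsum, S1, Pi.add_apply, Pi.smul_apply]
  module

/-- The square of the spin-Dirac operator in terms of the square of the standard Dirac operator. -/
lemma spinDirac_spinDirac_eq_standard [CovariantDerivative.ContMDiffCovariantDerivative nab ∞]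
    [CovariantDerivative.ContMDiffCovariantDerivative D ∞]
    (hnab : MetricCompatible g nab) (hD : MetricCompatible g D)
    (hs : ∀ a b c x, Ξ.Strain nab D a b c x = 0) {A : g.ClField} (hA : Ξ.SmoothField A) :
    Ξ.spinDirac nab (Ξ.spinDirac nab (Ξ.onUnit A)) = Ξ.onUnit (Ξ.dirac D (Ξ.dirac D A)
      + ∑ a, ∑ b, eta a b • (Ξ.S1 nab D a b A + Ξ.S2 nab a b A)
      + ∑ a, ∑ b, Ξ.thetaWedge a b * (Ξ.S1 nab D a b A + Ξ.S2 nab a b A)) := by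
  rw [Ξ.spinDirac_spinDirac hnab hA, Ξ.dirac_dirac_eq_standard hnab hD hs hA]
  refine congrArg Ξ.onUnit (funext fun x => ?_)
  simp only [Pi.add_apply _ _ x]
  rw [add_assoc (_ + _ + _), Ξ.eta_add_thetaWedge, add_assoc (Ξ.dirac D _ x),
    Ξ.eta_add_thetaWedge, add_assoc, add_assoc,
    Ξ.eta_add_thetaWedge fun a b => Ξ.S1 nab D a b A + Ξ.S2 nab a b A, ← Finset.sum_add_distrib]
  refine congrArg (Ξ.dirac D (Ξ.dirac D A) x + ·) (Finset.sum_congr rfl fun a _ => ?_)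
  rw [← Finset.sum_add_distrib]
  exact Finset.sum_congr rfl fun b _ => (mul_add _ _ _).symm

end SpinFrame

end

end RiemannCartan

open RiemannCartan in
theorem mainTheorem5
    {M : Type u} [TopologicalSpace M] [ChartedSpace E4 M] [IsManifold I4 ∞ M]
    (g : LorentzMetric M) (S : SpinStructure.{u, v, w} g) (Ξ : SpinFrame S)
    (nab : Connection M) [CovariantDerivative.ContMDiffCovariantDerivative nab ∞] (hnab : MetricCompatible g nab) :
    -- every left spin-Clifford field is `A 1^ℓ_Ξ` for exactly one Clifford field `A`
    (∀ ψ : S.SpinorField, S.SmoothSpinorField ψ →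
      ∃! A : g.ClField, S.SmoothClField A ∧ ψ = Ξ.onUnit A) ∧
    -- the square of the spin-Dirac operator and the square of the Dirac operator
    (∀ A : g.ClField, S.SmoothClField A →
      Ξ.spinDirac nab (Ξ.spinDirac nab (Ξ.onUnit A)) =
        Ξ.onUnit (Ξ.dirac nab (Ξ.dirac nab A)
          + ∑ a, ∑ b, eta a b • Ξ.S2 nab a b A
          + ∑ a, ∑ b, Ξ.thetaWedge a b * Ξ.S2 nab a b A)) ∧
    -- the square of the spin-Dirac operator and the square of the standard Dirac operator
    (∀ D : Connection M, CovariantDerivative.ContMDiffCovariantDerivative D ∞ → IsLeviCivita g D →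
      (∀ a b c x, Ξ.Strain nab D a b c x = 0) →
      ∀ A : g.ClField, S.SmoothClField A →
        Ξ.spinDirac nab (Ξ.spinDirac nab (Ξ.onUnit A)) =
          Ξ.onUnit (Ξ.dirac D (Ξ.dirac D A)
            + ∑ a, ∑ b, eta a b • (Ξ.S1 nab D a b A + Ξ.S2 nab a b A)
            + ∑ a, ∑ b, Ξ.thetaWedge a b * (Ξ.S1 nab D a b A + Ξ.S2 nab a b A))) := by
  refine ⟨fun ψ hψ => Ξ.existsUnique_onUnit hψ, fun A hA =>
    Ξ.spinDirac_spinDirac hnab (SpinFrame.smoothField_of_smoothClField hA),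
    fun D _ hD hs A hA => ?_⟩
  exact Ξ.spinDirac_spinDirac_eq_standard hnab hD.1 hs
    (SpinFrame.smoothField_of_smoothClField hA)
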